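/- Let $-1\le q\le 1$, $\theta\in\mathbb R$ and $\tau\ge 0$, and write $[n]_q=1+q+\dots+q^{n-1}$, $[0]_q=0$. For $x\in\mathbb R$ and $0\le s<t$ let $Q_n(y)=Q_n(y|x,s,t)$, $n\ge 0$, be the polynomials in $y$ given by $Q_0=1$, $Q_1(y)=y-x$ and $$yQ_n(y)=Q_{n+1}(y)+(\theta[n]_q+xq^n)\,Q_n(y)+(t-sq^{n-1}+\tau[n-1]_q)\,[n]_q\,Q_{n-1}(y),\qquad n\ge 1.$$ Then there is exactly one probability measure $\mu_{x,s,t}$ on $\mathbb R$ with finite moments of all orders such that $\int Q_mQ_n\,d\mu_{x,s,t}=0$ for all $m\ne n$; it depends measurably on $x$; and the Chapman--Kolmogorov equation holds: for all $x\in\mathbb R$, $0\le s<t<u$ and every Borel set $A\subseteq\mathbb R$, $$\mu_{x,s,u}(A)=\int_{\mathbb R}\mu_{y,t,u}(A)\,\mu_{x,s,t}(dy).$$ Hence the measures $\mu_{x,s,t}$ are the transition probabilities of a Markov process: for every $x_0\in\mathbb R$ there is a real stochastic process $(X_t)_{t\ge 0}$ on some probability space with $X_0=x_0$ almost surely such that,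 for all $0\le s<t$ and every Borel set $A$, almost surely $P(X_t\in A\mid \sigma(X_r: r\le s))=\mu_{X_s,s,t}(A)$. -/

import Mathlib

open MeasureTheory ProbabilityTheory
open scoped NNReal Polynomial

/-- The `q`-number `[n]_q = 1 + q + ⋯ + q ^ (n - 1)`, with `[0]_q = 0`. -/
noncomputable def qNumber (q : ℝ) (n : ℕ) : ℝ := ∑ i ∈ Finset.range n, q ^ i

/-- The monic polynomials `Q_n(y | x, s, t)` in the variable `y`, given by `Q_0 = 1`, `Q_1 = y - x`
and, for `n ≥ 1`,
`y Q_n = Q_{n+1} + (θ [n]_q + x q ^ n) Q_n + (t - s q ^ (n-1) + τ [n-1]_q) [n]_q Q_{n-1}`. -/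
noncomputable def qMeixnerPoly (q θ τ x s t : ℝ) : ℕ → ℝ[X]
  | 0 => 1
  | 1 => Polynomial.X - Polynomial.C x
  | n + 2 =>
      (Polynomial.X - Polynomial.C (θ * qNumber q (n + 1) + x * q ^ (n + 1)))
          * qMeixnerPoly q θ τ x s t (n + 1)
        - Polynomial.C ((t - s * q ^ n + τ * qNumber q n) * qNumber q (n + 1))
          * qMeixnerPoly q θ τ x s t n

/-- `μ` is a probability measure on the real line, with finite moments of all orders, with respect
to which the polynomials `Q 0, Q 1, …` are pairwise orthogonal. (Finitely supported measures are
allowed, so `∫ (Q n) ^ 2 ∂μ` may vanish.) -/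
structure IsOrthogonalityMeasure (Q : ℕ → ℝ[X]) (μ : Measure ℝ) : Prop where
  isProbabilityMeasure : IsProbabilityMeasure μ
  integrable_pow : ∀ n : ℕ, Integrable (fun y : ℝ => y ^ n) μ
  orthogonal : ∀ m n : ℕ, m ≠ n → ∫ y, (Q m).eval y * (Q n).eval y ∂μ = 0

/-- The measure `μ_{x,s,t}` that makes the polynomials `Q_n(· | x, s, t)` orthogonal
(an arbitrary measure if there is none). -/
noncomputable def qMeixnerMeasure (q θ τ x s t : ℝ) : Measure ℝ :=
  Classical.epsilon fun μ : Measure ℝ => IsOrthogonalityMeasure (qMeixnerPoly q θ τ x s t) μ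

/-- `(X_t)_{t ≥ 0}` is a real Markov process on `(Ω, P)` that starts at `x₀` and has the transition
probabilities `κ s t x (dy)`: for `s < t`, the conditional law of `X_t` given the `σ`-field generated
by `X_r`, `r ≤ s`, is `κ s t (X_s)`. -/
structure IsMarkovProcessWithTransitions {Ω : Type*} [MeasurableSpace Ω] (P : Measure Ω)
    (X : ℝ≥0 → Ω → ℝ) (κ : ℝ≥0 → ℝ≥0 → ℝ → Measure ℝ) (x₀ : ℝ) : Prop where
  isProbabilityMeasure : IsProbabilityMeasure P
  measurable : ∀ t, Measurable (X t)
  initial : ∀ᵐ ω ∂P, X 0 ω = x₀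
  transition : ∀ s t, s < t → ∀ A : Set ℝ, MeasurableSet A →
    P⟦X t ⁻¹' A | ⨆ r ≤ s, MeasurableSpace.comap (X r) inferInstance⟧
      =ᵐ[P] fun ω => (κ s t (X s ω)).real A

/-!
The polynomials `Q_n(y | x, s, t)` have a `q`-exponential generating function that is
multiplicative along `s < t < u`. In terms of coefficients this is the convolution identity
`Q_n(z | x, s, u) = ∑_{i + j = n} [n choose i]_q Q_i(y | x, s, t) Q_j(z | y, t, u)`, valid for all
real `y` (`eval_qMeixnerPoly_eq_sum`). It follows by induction from the three-term recurrence and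
the `q`-Leibniz rule; with `q`-binomial coefficients defined by `q`-Pascal's rule it also covers
`q = -1`. Integrating it in `z` against `μ_{y,t,u}` kills all terms with `j ≥ 1` and leaves
`Q_n(y | x, s, t)`, whose integral against `μ_{x,s,t}` is zero for `n ≥ 1`. So the composition of
the two kernels annihilates `Q_n(· | x, s, u)` for `n ≥ 1`, and this property characterizes
`μ_{x,s,u}`: that is the Chapman-Kolmogorov equation (`bind_qMeixnerMeasure`).

Existence of the measures is Favard's theorem for non-negative coefficients `b_n`, which may
vanish. The spectral measures of the truncated Jacobi matrices
(`IsThreeTermRecurrence.exists_quadrature`) have the right moments up to any given order, and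
bounded second moments make them tight; a weak limit has the right moments
(`exists_tendsto_of_tendsto_moments`). For uniqueness, the coefficients grow so slowly,
`a_n = O(n)` and `b_n = O(n ^ 2)`, that the `n`-th moment is at most `K ^ n n!`
(`abs_recurrenceCoeff_le`); the complex moment generating function is then analytic in a strip
around the imaginary axis and is determined by its Taylor coefficients at `0`
(`eq_of_integral_pow_eq`). The method of moments, together with uniqueness, also shows that
`μ_{x,s,t}` is weakly continuous, hence measurable, in `x`.

The process is the coordinate process on the space of all paths. The laws of the Markov chain at
finitely many times (`pathLaw`, `finiteDimLaw`) are consistent by the Chapman-Kolmogorov equation,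
and Kolmogorov's extension theorem (`exists_isProjectiveLimit`) provides the measure. The Markov
property is checked on events that depend on finitely many times, which form a `π`-system that
generates the past (`condProb_projectiveLimit_finiteDimLaw`).
-/

/-! ### `q`-binomial coefficients and the convolution identity -/

lemma qNumber_zero (q : ℝ) : qNumber q 0 = 0 := by simp [qNumber]

lemma qNumber_one (q : ℝ) : qNumber q 1 = 1 := by simp [qNumber]

lemma qNumber_add (q : ℝ) (i j : ℕ) : qNumber q (i + j) = qNumber q j + q ^ j * qNumber q i := by
  simp only [qNumber]
  rw [add_comm i j, Finset.sum_range_add, Finset.mul_sum]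
  simp only [pow_add]

/-- The `q`-binomial coefficient `[i + j choose i]_q`, as a function of `i` and `j`. The definition
by `q`-Pascal's rule is polynomial in `q`, so that it makes sense for `q = -1`, where the
`q`-factorials vanish. -/
noncomputable def qBinomial (q : ℝ) : ℕ → ℕ → ℝ
  | 0, _ => 1
  | _ + 1, 0 => 1
  | i + 1, j + 1 => qBinomial q (i + 1) j + q ^ (j + 1) * qBinomial q i (j + 1)

lemma qBinomial_zero_left (q : ℝ) (j : ℕ) : qBinomial q 0 j = 1 := by
  simp [qBinomial]

lemma qBinomial_zero_right (q : ℝ) (i : ℕ) : qBinomial q i 0 = 1 := by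
  cases i <;> simp [qBinomial]

lemma qBinomial_succ_succ (q : ℝ) (i j : ℕ) : qBinomial q (i + 1) (j + 1)
    = qBinomial q (i + 1) j + q ^ (j + 1) * qBinomial q i (j + 1) := by
  simp [qBinomial]

/-- The absorption identities `[i + 1 + j choose i + 1] [i + 1] = [i + j + 1] [i + j choose i]` and
`[i + j + 1 choose i] [j + 1] = [i + j + 1] [i + j choose i]`. -/
lemma qBinomial_mul_qNumber (q : ℝ) (n : ℕ) : ∀ i j : ℕ, i + j = n →
    qBinomial q (i + 1) j * qNumber q (i + 1) = qNumber q (i + j + 1) * qBinomial q i j ∧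
    qBinomial q i (j + 1) * qNumber q (j + 1) = qNumber q (i + j + 1) * qBinomial q i j := by
  induction n with
  | zero =>
    intro i j h
    obtain ⟨rfl, rfl⟩ : i = 0 ∧ j = 0 := by omega
    simp [qBinomial_zero_left, qBinomial_zero_right]
  | succ n ih =>
    intro i j h
    constructor
    · rcases j with _ | j
      · simp [qBinomial_zero_right]
      · have h1 := (ih i j (by omega)).1
        have h2 := (ih i j (by omega)).2
        have h3 := qNumber_add q (i + 1) (j + 1)
        rw [show i + 1 + (j + 1) = i + (j + 1) + 1 by ring] at h3
        rw [qBinomial_succ_succ, h3]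
        linear_combination h1 - h2
    · rcases i with _ | i
      · simp [qBinomial_zero_left]
      · have h1 := (ih i j (by omega)).1
        have h2 := (ih i j (by omega)).2
        have h3 := qNumber_add q (i + 1) (j + 1)
        rw [show i + 1 + (j + 1) = i + 1 + j + 1 by ring] at h3
        rw [qBinomial_succ_succ, h3]
        linear_combination q ^ (j + 1) * (h2 - h1)

open Finset in
/-- The `q`-Leibniz rule for the convolution with `q`-binomial weights. -/
lemma sum_qBinomial_succ (q : ℝ) (f : ℕ → ℕ → ℝ) (n : ℕ) :
    ∑ p ∈ antidiagonal (n + 1), qBinomial q p.1 p.2 * f p.1 p.2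
      = ∑ p ∈ antidiagonal n, qBinomial q p.1 p.2 * (f p.1 (p.2 + 1) + q ^ p.2 * f (p.1 + 1) p.2) := by
  have key : ∀ p ∈ antidiagonal (n + 1), qBinomial q p.1 p.2 * f p.1 p.2
      = (Nat.casesOn p.2 0 fun j => qBinomial q p.1 j * f p.1 (j + 1) : ℝ)
        + (Nat.casesOn p.1 0 fun i => qBinomial q i p.2 * (q ^ p.2 * f (i + 1) p.2) : ℝ) := by
    rintro ⟨i, j⟩ h
    rw [HasAntidiagonal.mem_antidiagonal] at h
    rcases i with _ | i <;> rcases j with _ | j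
    · simp at h
    · simp [qBinomial_zero_left]
    · simp [qBinomial_zero_right]
    · simp only [qBinomial_succ_succ]
      ring
  rw [sum_congr rfl key, sum_add_distrib, Nat.sum_antidiagonal_succ', Nat.sum_antidiagonal_succ]
  simp [mul_add, sum_add_distrib]

open Finset in
lemma sum_qBinomial_mul_qNumber_right (q : ℝ) (f : ℕ → ℕ → ℝ) (n : ℕ) :
    ∑ p ∈ antidiagonal (n + 1), qBinomial q p.1 p.2 * (qNumber q p.2 * f p.1 (p.2 - 1))
      = qNumber q (n + 1) * ∑ p ∈ antidiagonal n, qBinomial q p.1 p.2 * f p.1 p.2 := by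
  rw [Nat.sum_antidiagonal_succ', mul_sum]
  simp only [qNumber_zero, zero_mul, mul_zero, zero_add, Nat.add_sub_cancel]
  refine sum_congr rfl fun p hp => ?_
  rw [HasAntidiagonal.mem_antidiagonal] at hp
  have := (qBinomial_mul_qNumber q n p.1 p.2 hp).2
  rw [hp] at this
  linear_combination f p.1 p.2 * this

open Finset in
lemma sum_qBinomial_mul_qNumber_left (q : ℝ) (f : ℕ → ℕ → ℝ) (n : ℕ) :
    ∑ p ∈ antidiagonal (n + 1), qBinomial q p.1 p.2 * (qNumber q p.1 * f (p.1 - 1) p.2)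
      = qNumber q (n + 1) * ∑ p ∈ antidiagonal n, qBinomial q p.1 p.2 * f p.1 p.2 := by
  rw [Nat.sum_antidiagonal_succ, mul_sum]
  simp only [qNumber_zero, zero_mul, mul_zero, zero_add, Nat.add_sub_cancel]
  refine sum_congr rfl fun p hp => ?_
  rw [HasAntidiagonal.mem_antidiagonal] at hp
  have := (qBinomial_mul_qNumber q n p.1 p.2 hp).1
  rw [hp] at this
  linear_combination f p.1 p.2 * this

lemma qMeixnerPoly_zero (q θ τ x s t : ℝ) : qMeixnerPoly q θ τ x s t 0 = 1 := rfl

lemma qMeixnerPoly_one (q θ τ x s t : ℝ) :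
    qMeixnerPoly q θ τ x s t 1 = Polynomial.X - Polynomial.C x := rfl

/-- The recurrence of the definition, written for all `n ≥ 0`: the last term vanishes for `n = 0`
because `[0]_q = 0`, whatever the truncated `0 - 1` stands for. -/
lemma eval_qMeixnerPoly_succ (q θ τ x s t y : ℝ) (n : ℕ) :
    (qMeixnerPoly q θ τ x s t (n + 1)).eval y
      = (y - θ * qNumber q n - x * q ^ n) * (qMeixnerPoly q θ τ x s t n).eval y
        - qNumber q n * ((t - s * q ^ (n - 1) + τ * qNumber q (n - 1))
          * (qMeixnerPoly q θ τ x s t (n - 1)).eval y) := by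
  rcases n with _ | n
  · simp [qNumber_zero, qMeixnerPoly_zero, qMeixnerPoly_one]
  · simp only [qMeixnerPoly, Polynomial.eval_sub, Polynomial.eval_mul, Polynomial.eval_X,
      Polynomial.eval_C, Nat.add_sub_cancel]
    ring

open Finset in
/-- The convolution identity. In terms of the `q`-exponential generating functions
`F_{x,s,t}(ζ, y) = ∑ Q_n(y | x, s, t) ζ ^ n / [n]_q!` it says
`F_{x,s,u}(ζ, z) = F_{x,s,t}(ζ, y) F_{y,t,u}(ζ, z)`. -/
theorem eval_qMeixnerPoly_eq_sum (q θ τ x s t u y z : ℝ) (n : ℕ) :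
    (qMeixnerPoly q θ τ x s u n).eval z
      = ∑ p ∈ antidiagonal n, qBinomial q p.1 p.2 *
          ((qMeixnerPoly q θ τ x s t p.1).eval y * (qMeixnerPoly q θ τ y t u p.2).eval z) := by
  set a : ℕ → ℝ := fun i => (qMeixnerPoly q θ τ x s t i).eval y with ha
  set b : ℕ → ℝ := fun j => (qMeixnerPoly q θ τ y t u j).eval z with hb
  -- The `q`-Leibniz rule with the recurrences of both factors inserted. The variable `y` cancels:
  -- the second factor contributes `z - ⋯ - y q ^ j`, the first one `q ^ j (y - ⋯)`.
  have step : ∀ n, ∑ p ∈ antidiagonal (n + 1), qBinomial q p.1 p.2 * (a p.1 * b p.2)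
      = (z - θ * qNumber q n - x * q ^ n)
          * ∑ p ∈ antidiagonal n, qBinomial q p.1 p.2 * (a p.1 * b p.2)
        - ∑ p ∈ antidiagonal n, qBinomial q p.1 p.2 * (qNumber q p.2 *
            (a p.1 * ((u - t * q ^ (p.2 - 1) + τ * qNumber q (p.2 - 1)) * b (p.2 - 1))))
        - ∑ p ∈ antidiagonal n, qBinomial q p.1 p.2 * (qNumber q p.1 *
            (q ^ p.2 * ((t - s * q ^ (p.1 - 1) + τ * qNumber q (p.1 - 1)) * a (p.1 - 1)
              * b p.2))) := by
    intro n
    rw [sum_qBinomial_succ q (fun i j => a i * b j), mul_sum, ← sum_sub_distrib, ← sum_sub_distrib]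
    refine sum_congr rfl fun p hp => ?_
    rw [HasAntidiagonal.mem_antidiagonal] at hp
    have h1 := eval_qMeixnerPoly_succ q θ τ x s t y p.1
    have h2 := eval_qMeixnerPoly_succ q θ τ y t u z p.2
    have h3 := qNumber_add q p.1 p.2
    have h4 := pow_add q p.1 p.2
    rw [hp] at h3 h4
    simp only [ha, hb, h1, h2, h3, h4]
    ring
  induction n using Nat.twoStepInduction with
  | zero => simp [qMeixnerPoly_zero, qBinomial_zero_left]
  | one =>
    rw [step 0]
    simp [qMeixnerPoly_zero, qMeixnerPoly_one, qNumber_zero, qBinomial_zero_left, ha, hb]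
  | more n ih ih' =>
    -- The coefficients of the two lower-order sums add up to that of the recurrence for `(x, s, u)`.
    have comb : (u - s * q ^ n + τ * qNumber q n)
          * ∑ p ∈ antidiagonal n, qBinomial q p.1 p.2 * (a p.1 * b p.2)
        = ∑ p ∈ antidiagonal n, qBinomial q p.1 p.2
            * (a p.1 * ((u - t * q ^ p.2 + τ * qNumber q p.2) * b p.2))
          + ∑ p ∈ antidiagonal n, qBinomial q p.1 p.2
            * (q ^ p.2 * ((t - s * q ^ p.1 + τ * qNumber q p.1) * a p.1 * b p.2)) := by
      rw [mul_sum, ← sum_add_distrib]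
      refine sum_congr rfl fun p hp => ?_
      rw [HasAntidiagonal.mem_antidiagonal] at hp
      have h3 := qNumber_add q p.1 p.2
      have h4 := pow_add q p.1 p.2
      rw [hp] at h3 h4
      rw [h3, h4]
      ring
    rw [step (n + 1),
      sum_qBinomial_mul_qNumber_right q (fun i j => a i * ((u - t * q ^ j + τ * qNumber q j) * b j)),
      sum_qBinomial_mul_qNumber_left q
        (fun i j => q ^ j * ((t - s * q ^ i + τ * qNumber q i) * a i * b j)),
      eval_qMeixnerPoly_succ, Nat.add_sub_cancel, ih', ih]
    linear_combination -qNumber q (n + 1) * comb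

/-! ### Moments from a three-term recurrence -/

/-- The monic polynomials `Q n` satisfy the three-term recurrence
`X Q_n = Q_{n+1} + a_n Q_n + b_{n-1} Q_{n-1}`. -/
structure IsThreeTermRecurrence (Q : ℕ → ℝ[X]) (a b : ℕ → ℝ) : Prop where
  zero : Q 0 = 1
  one : Q 1 = Polynomial.X - Polynomial.C (a 0)
  add_two : ∀ n, Q (n + 2) = (Polynomial.X - Polynomial.C (a (n + 1))) * Q (n + 1)
    - Polynomial.C (b n) * Q n

/-- The coefficient of `Q_j` in the expansion of `X ^ n`, for polynomials with the three-term
recurrence given by `a` and `b`. -/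
def recurrenceCoeff (a b : ℕ → ℝ) : ℕ → ℕ → ℝ
  | 0, j => if j = 0 then 1 else 0
  | n + 1, 0 => a 0 * recurrenceCoeff a b n 0 + b 0 * recurrenceCoeff a b n 1
  | n + 1, j + 1 => recurrenceCoeff a b n j + a (j + 1) * recurrenceCoeff a b n (j + 1)
      + b (j + 1) * recurrenceCoeff a b n (j + 2)

lemma recurrenceCoeff_eq_zero (a b : ℕ → ℝ) (n : ℕ) : ∀ j, n < j → recurrenceCoeff a b n j = 0 := by
  induction n with
  | zero => intro j hj; simp [recurrenceCoeff, hj.ne']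
  | succ n ih =>
    intro j hj
    rcases j with _ | j
    · omega
    · simp [recurrenceCoeff, ih j (by omega), ih (j + 1) (by omega), ih (j + 2) (by omega)]

lemma IsThreeTermRecurrence.X_mul_zero {Q : ℕ → ℝ[X]} {a b : ℕ → ℝ}
    (h : IsThreeTermRecurrence Q a b) :
    Polynomial.X * Q 0 = Q 1 + Polynomial.C (a 0) * Q 0 := by
  rw [h.zero, h.one]; ring

lemma IsThreeTermRecurrence.X_mul_succ {Q : ℕ → ℝ[X]} {a b : ℕ → ℝ}
    (h : IsThreeTermRecurrence Q a b) (n : ℕ) :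
    Polynomial.X * Q (n + 1) = Q (n + 2) + Polynomial.C (a (n + 1)) * Q (n + 1)
      + Polynomial.C (b n) * Q n := by
  rw [h.add_two]; ring

open Finset in
lemma IsThreeTermRecurrence.X_pow_eq_sum {Q : ℕ → ℝ[X]} {a b : ℕ → ℝ}
    (h : IsThreeTermRecurrence Q a b) (n : ℕ) :
    Polynomial.X ^ n = ∑ j ∈ range (n + 1), Polynomial.C (recurrenceCoeff a b n j) * Q j := by
  induction n with
  | zero => simp [recurrenceCoeff, h.zero]
  | succ n ih =>
    set c := recurrenceCoeff a b n with hc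
    have hz : ∀ j, n < j → c j = 0 := recurrenceCoeff_eq_zero a b n
    -- the three diagonals of the recurrence, summed separately
    have e1 : ∑ j ∈ range (n + 1), Polynomial.C (a (j + 1) * c (j + 1)) * Q (j + 1)
        + Polynomial.C (a 0 * c 0) * Q 0
        = ∑ j ∈ range (n + 1), Polynomial.C (a j * c j) * Q j := by
      rw [← sum_range_succ' (fun j => Polynomial.C (a j * c j) * Q j), sum_range_succ,
        hz (n + 1) (by omega)]
      simp
    have e2 : ∑ j ∈ range (n + 1), Polynomial.C (b (j + 1) * c (j + 2)) * Q (j + 1)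
        + Polynomial.C (b 0 * c 1) * Q 0
        = ∑ j ∈ range n, Polynomial.C (b j * c (j + 1)) * Q j := by
      rw [← sum_range_succ' (fun j => Polynomial.C (b j * c (j + 1)) * Q j), sum_range_succ,
        sum_range_succ, hz (n + 1) (by omega), hz (n + 1 + 1) (by omega)]
      simp
    have e3 : ∑ j ∈ range (n + 1), Polynomial.C (c j) * (Polynomial.X * Q j)
        = ∑ j ∈ range (n + 1), Polynomial.C (c j) * Q (j + 1)
          + ∑ j ∈ range (n + 1), Polynomial.C (a j * c j) * Q j
          + ∑ j ∈ range n, Polynomial.C (b j * c (j + 1)) * Q j := by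
      rw [sum_range_succ' (fun j => Polynomial.C (c j) * (Polynomial.X * Q j)),
        sum_range_succ' (fun j => Polynomial.C (c j) * Q (j + 1)),
        sum_range_succ' (fun j => Polynomial.C (a j * c j) * Q j), h.X_mul_zero]
      have g1 : ∀ k, Polynomial.C (a k * c k) * Q k
          = Polynomial.C (c k) * (Polynomial.C (a k) * Q k) := fun k => by
        rw [Polynomial.C_mul]; ring
      have g2 : ∀ k, Polynomial.C (b k * c (k + 1)) * Q k
          = Polynomial.C (c (k + 1)) * (Polynomial.C (b k) * Q k) := fun k => by
        rw [Polynomial.C_mul]; ring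
      simp only [h.X_mul_succ, mul_add, sum_add_distrib, g1, g2]
      ring
    rw [pow_succ', ih, mul_sum,
      sum_range_succ' (fun j => Polynomial.C (recurrenceCoeff a b (n + 1) j) * Q j)]
    simp only [recurrenceCoeff, ← hc, Polynomial.C_add, add_mul, sum_add_distrib]
    rw [sum_congr rfl fun j _ => mul_left_comm Polynomial.X (Polynomial.C (c j)) (Q j), e3, ← e1,
      ← e2]
    ring

/-- If `b_j` grows at most quadratically and `a_j` at most linearly, the expansion coefficients of
`X ^ n` are of order `K ^ n n!`. -/
lemma abs_recurrenceCoeff_le {a b : ℕ → ℝ} {A : ℝ} (ha : ∀ j, |a j| ≤ A * (j + 1))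
    (hb : ∀ j, |b j| ≤ A * (j + 1) ^ 2) (n : ℕ) :
    ∀ j, |recurrenceCoeff a b n j| * (j.factorial : ℝ) ≤ (1 + 2 * A) ^ n * n.factorial := by
  have hA : 0 ≤ A := by
    have := (abs_nonneg _).trans (ha 0); simpa using this
  induction n with
  | zero =>
    intro j
    rcases j with _ | j <;> simp [recurrenceCoeff]
  | succ n ih =>
    set M := (1 + 2 * A) ^ n * (n.factorial : ℝ) with hM
    have hM0 : 0 ≤ M := by positivity
    have hMs : (1 + 2 * A) ^ (n + 1) * ((n + 1).factorial : ℝ) = (1 + 2 * A) * (n + 1) * M := by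
      rw [hM, Nat.factorial_succ]; push_cast; ring
    rw [hMs]
    set c := recurrenceCoeff a b n with hc
    have h2 : ∀ j, |a j * c j| * (j.factorial : ℝ) ≤ A * (j + 1) * M := fun j => by
      rw [abs_mul, mul_assoc]
      exact mul_le_mul (ha j) (ih j) (by positivity) (by positivity)
    have h3 : ∀ j, |b j * c (j + 1)| * (j.factorial : ℝ) ≤ A * (j + 1) * M := fun j => by
      have := mul_le_mul (hb j) (ih (j + 1)) (by positivity) (by positivity)
      rw [Nat.factorial_succ, Nat.cast_mul] at this
      rw [abs_mul]
      have hj : (0 : ℝ) < (j : ℝ) + 1 := by positivity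
      push_cast at this
      nlinarith
    intro j
    rcases lt_or_ge (n + 1) j with hj | hj
    · rw [recurrenceCoeff_eq_zero a b _ _ hj]
      simp only [abs_zero, zero_mul]
      positivity
    rcases j with _ | j
    · simp only [recurrenceCoeff, ← hc]
      have h4 := abs_add_le (a 0 * c 0) (b 0 * c 1)
      have h5 := h2 0
      have h6 := h3 0
      simp only [Nat.factorial_zero, Nat.cast_one, mul_one, Nat.cast_zero, zero_add] at *
      have : 0 ≤ (n : ℝ) * M := by positivity
      nlinarith [mul_nonneg hA this]
    · simp only [recurrenceCoeff, ← hc]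
      have hjf : (0 : ℝ) ≤ ((j + 1).factorial : ℝ) := by positivity
      have h4 : |c j + a (j + 1) * c (j + 1) + b (j + 1) * c (j + 2)| * ((j + 1).factorial : ℝ)
          ≤ (|c j| + |a (j + 1) * c (j + 1)| + |b (j + 1) * c (j + 2)|)
            * ((j + 1).factorial : ℝ) := by
        gcongr
        exact abs_add_three _ _ _
      have h1 : |c j| * ((j + 1).factorial : ℝ) ≤ (j + 1) * M := by
        rw [Nat.factorial_succ]; push_cast
        have := ih j
        have hj : (0 : ℝ) < (j : ℝ) + 1 := by positivity
        nlinarith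
      rcases hj.lt_or_eq with hj | hj
      · have h5 := h2 (j + 1)
        have h6 := h3 (j + 1)
        push_cast at h5 h6
        have hjn : (j : ℝ) + 1 ≤ n := by exact_mod_cast Nat.lt_succ_iff.mp hj
        have h7 : A * (j + 1 + 1) * M ≤ A * (n + 1) * M := by gcongr
        have h8 : ((j : ℝ) + 1) * M ≤ n * M := by gcongr
        nlinarith
      · have hjn : j = n := by omega
        subst hjn
        have z1 : c (j + 1) = 0 := recurrenceCoeff_eq_zero a b _ _ (by omega)
        have z2 : c (j + 2) = 0 := recurrenceCoeff_eq_zero a b _ _ (by omega)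
        rw [z1, z2] at h4 ⊢
        simp only [mul_zero, abs_zero, add_zero] at h4 ⊢
        have h7 : 0 ≤ A * ((j + 1) * M) := by positivity
        nlinarith

lemma integrable_eval {μ : Measure ℝ} (hμ : ∀ n : ℕ, Integrable (fun y : ℝ => y ^ n) μ) (p : ℝ[X]) :
    Integrable (fun y => p.eval y) μ := by
  simp only [Polynomial.eval_eq_sum_range]
  exact integrable_finsetSum _ fun i _ => (hμ i).const_mul _

lemma integral_eval {μ : Measure ℝ} (hμ : ∀ n : ℕ, Integrable (fun y : ℝ => y ^ n) μ) (p : ℝ[X]) :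
    ∫ y, p.eval y ∂μ = ∑ i ∈ Finset.range (p.natDegree + 1), p.coeff i * ∫ y, y ^ i ∂μ := by
  simp only [Polynomial.eval_eq_sum_range]
  rw [integral_finsetSum _ fun i _ => (hμ i).const_mul _]
  simp only [integral_const_mul]

/-- A probability measure that annihilates `Q_1, …, Q_n` has the moments prescribed by the
recurrence, up to order `n`. -/
lemma IsThreeTermRecurrence.integral_pow {Q : ℕ → ℝ[X]} {a b : ℕ → ℝ}
    (h : IsThreeTermRecurrence Q a b) {μ : Measure ℝ} [IsProbabilityMeasure μ]
    (hμ : ∀ n : ℕ, Integrable (fun y : ℝ => y ^ n) μ) {n : ℕ}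
    (hQ : ∀ j, 1 ≤ j → j ≤ n → ∫ y, (Q j).eval y ∂μ = 0) :
    ∫ y, y ^ n ∂μ = recurrenceCoeff a b n 0 := by
  have e : ∀ y : ℝ, y ^ n = ∑ j ∈ Finset.range (n + 1), recurrenceCoeff a b n j * (Q j).eval y := by
    intro y
    have := congrArg (Polynomial.eval y) (h.X_pow_eq_sum n)
    simpa [Polynomial.eval_finsetSum] using this
  simp only [e]
  rw [integral_finsetSum _ fun i _ => (integrable_eval hμ _).const_mul _, Finset.sum_range_succ',
    Finset.sum_eq_zero]
  · simp [h.zero]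
  · intro j hj
    rw [integral_const_mul, hQ (j + 1) (by omega) (by simpa using hj), mul_zero]

lemma continuous_recurrenceCoeff {X : Type*} [TopologicalSpace X] {a b : X → ℕ → ℝ}
    (ha : ∀ j, Continuous fun x => a x j) (hb : ∀ j, Continuous fun x => b x j) (n : ℕ) :
    ∀ j, Continuous fun x => recurrenceCoeff (a x) (b x) n j := by
  induction n with
  | zero => intro j; simp only [recurrenceCoeff]; fun_prop
  | succ n ih =>
    intro j
    rcases j with _ | j <;> simp only [recurrenceCoeff]
    · exact ((ha 0).mul (ih 0)).add ((hb 0).mul (ih 1))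
    · exact ((ih j).add ((ha _).mul (ih _))).add ((hb _).mul (ih _))

/-! ### Gauss quadrature -/

/-- The truncated symmetric Jacobi matrix, with diagonal `a` and off-diagonal entries `√b`. -/
noncomputable def jacobiMatrix (a b : ℕ → ℝ) (N : ℕ) : Matrix (Fin (N + 1)) (Fin (N + 1)) ℝ :=
  fun i j => if (i : ℕ) = j then a i else if (i : ℕ) + 1 = j then √(b i)
    else if (j : ℕ) + 1 = i then √(b j) else 0

lemma jacobiMatrix_isHermitian (a b : ℕ → ℝ) (N : ℕ) : (jacobiMatrix a b N).IsHermitian := by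
  ext i j
  simp only [Matrix.conjTranspose_apply, jacobiMatrix, star_trivial]
  split_ifs <;> first | rfl | omega | congr 1

/-- Cyclicity of the first basis vector: `Q_n(J) e_0` is a multiple of `e_n`. -/
lemma aeval_jacobiMatrix_single {Q : ℕ → ℝ[X]} {a b : ℕ → ℝ} (h : IsThreeTermRecurrence Q a b)
    (hb : ∀ n, 0 ≤ b n) (N n : ℕ) (hn : n < N + 1) :
    Polynomial.aeval (Matrix.toEuclideanLin (jacobiMatrix a b N)) (Q n)
        (EuclideanSpace.single 0 1)
      = (∏ k ∈ Finset.range n, √(b k)) • EuclideanSpace.single ⟨n, hn⟩ (1 : ℝ) := by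
  set T := Matrix.toEuclideanLin (jacobiMatrix a b N) with hT
  have T_apply : ∀ i j, T (EuclideanSpace.single j 1) i = jacobiMatrix a b N i j := by
    intro i j
    simp [hT, Matrix.toLpLin_apply]
  induction n using Nat.twoStepInduction with
  | zero => simp [h.zero]
  | one =>
    ext ⟨i, hi⟩
    simp only [h.one, map_sub, Polynomial.aeval_X, Polynomial.aeval_C, LinearMap.sub_apply,
      PiLp.sub_apply, T_apply, Module.algebraMap_end_apply, PiLp.smul_apply, jacobiMatrix,
      PiLp.single_apply, Finset.prod_range_one, Fin.ext_iff, Fin.val_zero, smul_eq_mul]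
    rcases i with _ | _ | i <;> simp
  | more n ih ih' =>
    have ih := ih (by omega)
    have ih' := ih' (by omega)
    simp only [h.add_two, map_sub, map_mul, Polynomial.aeval_X, Polynomial.aeval_C,
      LinearMap.sub_apply, Module.End.mul_apply, Module.algebraMap_end_apply, ih, ih', map_smul]
    have hs := Real.mul_self_sqrt (hb n)
    ext ⟨i, hi⟩
    simp only [PiLp.sub_apply, PiLp.smul_apply, T_apply, jacobiMatrix,
      PiLp.single_apply, Finset.prod_range_succ, Fin.ext_iff, smul_eq_mul]
    split_ifs <;> first | omega | ring1 | subst_vars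
    · ring
    · linear_combination (∏ k ∈ Finset.range i, √(b k)) * hs

/-- Gauss quadrature: the first `N + 1` of the polynomials are orthogonal with respect to a
finitely supported probability measure, the spectral measure of the truncated Jacobi matrix at the
first basis vector. -/
lemma IsThreeTermRecurrence.exists_quadrature {Q : ℕ → ℝ[X]} {a b : ℕ → ℝ}
    (h : IsThreeTermRecurrence Q a b) (hb : ∀ n, 0 ≤ b n) (N : ℕ) :
    ∃ μ : Measure ℝ, IsProbabilityMeasure μ ∧ (∀ n : ℕ, Integrable (fun y : ℝ => y ^ n) μ) ∧
      ∀ m n, m ≤ N → n ≤ N → m ≠ n → ∫ y, (Q m).eval y * (Q n).eval y ∂μ = 0 := by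
  set T := Matrix.toEuclideanLin (jacobiMatrix a b N) with hT
  have hS : T.IsSymmetric := Matrix.isSymmetric_toEuclideanLin_iff.2 (jacobiMatrix_isHermitian a b N)
  have hd : Module.finrank ℝ (EuclideanSpace ℝ (Fin (N + 1))) = N + 1 := by simp
  set v := hS.eigenvectorBasis hd with hv
  set ev := hS.eigenvalues hd with hev
  set e0 : EuclideanSpace ℝ (Fin (N + 1)) := EuclideanSpace.single 0 1 with he0
  have hTv : ∀ i, T (v i) = ev i • v i := fun i => hS.apply_eigenvectorBasis hd i
  have hp : ∀ (p : ℝ[X]) i, inner ℝ (v i) (Polynomial.aeval T p e0) = p.eval (ev i) * inner ℝ (v i) e0 := by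
    intro p i
    induction p using Polynomial.induction_on' with
    | add p r hp hr => simp only [map_add, LinearMap.add_apply, inner_add_right, hp, hr,
        Polynomial.eval_add, add_mul]
    | monomial n c =>
      rw [← Polynomial.C_mul_X_pow_eq_monomial]
      simp only [map_mul, map_pow, Polynomial.aeval_X, Polynomial.aeval_C, Module.End.mul_apply,
        Module.algebraMap_end_apply, inner_smul_right, Polynomial.eval_mul, Polynomial.eval_C,
        Polynomial.eval_pow, Polynomial.eval_X, mul_assoc]
      congr 1
      induction n with
      | zero => simp
      | succ n ih =>
        rw [pow_succ', Module.End.mul_apply, ← hS, hTv, inner_smul_left, ih]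
        simp only [RCLike.conj_to_real]
        ring
  -- the spectral measure of `T` at `e0`
  set μ : Measure ℝ := ∑ i, ENNReal.ofReal (inner ℝ (v i) e0 ^ 2) • Measure.dirac (ev i) with hμ
  have hint : ∀ f : ℝ → ℝ, Integrable f μ := fun f => by
    rw [hμ, integrable_finsetSum_measure]
    exact fun i _ => (integrable_dirac (by finiteness)).smul_measure (by finiteness)
  have hI : ∀ p r : ℝ[X], ∫ y, p.eval y * r.eval y ∂μ
      = inner ℝ (Polynomial.aeval T p e0) (Polynomial.aeval T r e0) := by
    intro p r
    rw [hμ, integral_finsetSum_measure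
      fun i _ => (integrable_dirac (by finiteness)).smul_measure (by finiteness),
      ← v.sum_inner_mul_inner]
    refine Finset.sum_congr rfl fun i _ => ?_
    rw [integral_smul_measure, integral_dirac, ENNReal.toReal_ofReal (sq_nonneg _), hp,
      real_inner_comm (v i), hp, smul_eq_mul]
    ring
  have h1 : ∫ y, (1 : ℝ) ∂μ = 1 := by
    have := hI 1 1
    simpa [he0] using this
  refine ⟨μ, ⟨?_⟩, fun n => hint _, fun m n hm hn hmn => ?_⟩
  · have hfin : IsFiniteMeasure μ := by
      have := hint (fun _ => 1)
      rw [integrable_const_iff] at this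
      exact this.resolve_left one_ne_zero
    rw [integral_const, smul_eq_mul, mul_one, measureReal_def] at h1
    rw [← ENNReal.ofReal_toReal (measure_ne_top μ Set.univ), h1, ENNReal.ofReal_one]
  · rw [hI, aeval_jacobiMatrix_single h hb N m (by omega),
      aeval_jacobiMatrix_single h hb N n (by omega)]
    simp [inner_smul_left, inner_smul_right, EuclideanSpace.inner_single_left, hmn]

/-! ### Determinacy of measures with factorially bounded moments -/

/-- The moment bound makes `cosh (y / (2 K))` integrable, term by term in its power series. -/
lemma zero_mem_interior_integrableExpSet {μ : Measure ℝ}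
    (hμ : ∀ n : ℕ, Integrable (fun y : ℝ => y ^ n) μ) {K : ℝ} (hK : 0 < K)
    (hb : ∀ n, |∫ y, y ^ n ∂μ| ≤ K ^ n * n.factorial) :
    0 ∈ interior (integrableExpSet id μ) := by
  set ε : ℝ := 1 / (2 * K) with hε
  have hε0 : 0 < ε := by positivity
  have hterm : ∀ n, ∫⁻ y, ENNReal.ofReal ((ε * y) ^ (2 * n) / (2 * n).factorial) ∂μ
      ≤ ENNReal.ofReal ((1 / 4) ^ n) := by
    intro n
    have e : ∀ y : ℝ, (ε * y) ^ (2 * n) / (2 * n).factorial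
        = (ε ^ (2 * n) / (2 * n).factorial) * y ^ (2 * n) := fun y => by ring
    rw [← ofReal_integral_eq_lintegral_ofReal]
    · apply ENNReal.ofReal_le_ofReal
      simp only [e, integral_const_mul]
      have h1 := (le_abs_self _).trans (hb (2 * n))
      calc ε ^ (2 * n) / (2 * n).factorial * ∫ y, y ^ (2 * n) ∂μ
          ≤ ε ^ (2 * n) / (2 * n).factorial * (K ^ (2 * n) * (2 * n).factorial) := by gcongr
        _ = (ε * K) ^ (2 * n) := by
          have : ((2 * n).factorial : ℝ) ≠ 0 := by positivity
          rw [mul_pow]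
          field_simp
        _ = (1 / 4) ^ n := by
          rw [show ε * K = 1 / 2 by rw [hε]; field_simp, pow_mul]; norm_num
    · simp only [e]; exact (hμ _).const_mul _
    · refine ae_of_all _ fun y => ?_
      have : 0 ≤ (ε * y) ^ (2 * n) := (even_two_mul n).pow_nonneg _
      simp only [Pi.zero_apply]
      positivity
  have hcosh : Integrable (fun y => Real.cosh (ε * y)) μ := by
    refine ⟨(Real.continuous_cosh.comp (continuous_const.mul continuous_id)).aestronglyMeasurable, ?_⟩
    rw [hasFiniteIntegral_iff_ofReal (ae_of_all _ fun y => (Real.cosh_pos _).le)]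
    have e : ∀ y : ℝ, ENNReal.ofReal (Real.cosh (ε * y))
        = ∑' n : ℕ, ENNReal.ofReal ((ε * y) ^ (2 * n) / (2 * n).factorial) := by
      intro y
      rw [← ENNReal.ofReal_tsum_of_nonneg, (Real.hasSum_cosh (ε * y)).tsum_eq]
      · intro n
        have : 0 ≤ (ε * y) ^ (2 * n) := (even_two_mul n).pow_nonneg _
        positivity
      · exact (Real.hasSum_cosh (ε * y)).summable
    simp only [e]
    rw [lintegral_tsum fun n => by fun_prop]
    refine (ENNReal.tsum_le_tsum hterm).trans_lt ?_
    rw [← ENNReal.ofReal_tsum_of_nonneg (fun n => by positivity)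
      (summable_geometric_of_lt_one (by norm_num) (by norm_num))]
    exact ENNReal.ofReal_lt_top
  have hexp : ∀ t : ℝ, |t| = ε → Integrable (fun y => Real.exp (t * id y)) μ := by
    intro t ht
    refine (hcosh.const_mul 2).mono' (by fun_prop) (ae_of_all _ fun y => ?_)
    rw [Real.norm_eq_abs, Real.abs_exp, Real.cosh_eq]
    rcases abs_eq hε0.le |>.1 ht with rfl | rfl
    · have := Real.exp_pos (-(ε * y)); simp only [id]; linarith
    · have := Real.exp_pos (ε * y); simp only [id, neg_mul]; linarith
  refine mem_interior.2 ⟨Set.Ioo (-ε) ε, fun t ht => ?_, isOpen_Ioo, by simp [hε0]⟩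
  refine integrable_exp_mul_of_abs_le (u := ε) (hexp _ (abs_of_pos hε0))
    (hexp _ (by rw [abs_neg, abs_of_pos hε0])) ?_
  rw [abs_of_pos hε0]
  exact abs_le.2 ⟨ht.1.le, ht.2.le⟩

/-- A probability measure is determined by its moments `m_n` if `|m_n| ≤ K ^ n n!`: the
moment generating function is then analytic near `0`. -/
theorem eq_of_integral_pow_eq {μ ν : Measure ℝ} [IsProbabilityMeasure μ] [IsProbabilityMeasure ν]
    (hμ : ∀ n : ℕ, Integrable (fun y : ℝ => y ^ n) μ)
    (hν : ∀ n : ℕ, Integrable (fun y : ℝ => y ^ n) ν) {K : ℝ} (hK : 0 < K)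
    (hb : ∀ n, |∫ y, y ^ n ∂μ| ≤ K ^ n * n.factorial)
    (hμν : ∀ n, ∫ y, y ^ n ∂ν = ∫ y, y ^ n ∂μ) : ν = μ := by
  have iμ := zero_mem_interior_integrableExpSet hμ hK hb
  have iν := zero_mem_interior_integrableExpSet hν hK (fun n => by rw [hμν]; exact hb n)
  have hmgf : mgf id ν =ᶠ[nhds 0] mgf id μ := by
    have p1 : HasFPowerSeriesAt (mgf id μ) (FormalMultilinearSeries.ofScalars ℝ
        fun n => (∫ y, id y ^ n * Real.exp (0 * id y) ∂μ) / (n.factorial : ℝ)) 0 :=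
      hasFPowerSeriesAt_mgf iμ
    have p2 : HasFPowerSeriesAt (mgf id ν) (FormalMultilinearSeries.ofScalars ℝ
        fun n => (∫ y, id y ^ n * Real.exp (0 * id y) ∂ν) / (n.factorial : ℝ)) 0 :=
      hasFPowerSeriesAt_mgf iν
    have e : (fun n => (∫ y, id y ^ n * Real.exp (0 * id y) ∂ν) / (n.factorial : ℝ))
        = fun n => (∫ y, id y ^ n * Real.exp (0 * id y) ∂μ) / (n.factorial : ℝ) := by
      funext n
      simp [hμν]
    rw [e] at p2
    have p := p2.sub p1
    rw [sub_self] at p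
    filter_upwards [p.eventually_eq_zero] with x hx
    exact sub_eq_zero.1 hx
  set U : Set ℂ := {z | z.re ∈ interior (integrableExpSet id μ)}
    ∩ {z | z.re ∈ interior (integrableExpSet id ν)} with hU
  have hEq : Set.EqOn (complexMGF id ν) (complexMGF id μ) U := by
    refine AnalyticOnNhd.eqOn_of_preconnected_of_frequently_eq (z₀ := 0)
      (analyticOnNhd_complexMGF.mono Set.inter_subset_right)
      (analyticOnNhd_complexMGF.mono Set.inter_subset_left) ?_ ⟨by simpa using iμ, by simpa using iν⟩ ?_
    · exact ((convex_integrableExpSet.interior.linear_preimage Complex.reLm).inter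
        (convex_integrableExpSet.interior.linear_preimage Complex.reLm)).isPreconnected
    · have h1 : ∃ᶠ x : ℝ in nhdsWithin 0 {0}ᶜ, complexMGF id ν x = complexMGF id μ x := by
        refine Filter.Eventually.frequently ?_
        filter_upwards [hmgf.filter_mono nhdsWithin_le_nhds] with x hx
        rw [complexMGF_ofReal, complexMGF_ofReal, hx]
      have h2 : Filter.Tendsto (fun x : ℝ => (x : ℂ)) (nhdsWithin 0 {0}ᶜ) (nhdsWithin 0 {0}ᶜ) := by
        refine tendsto_nhdsWithin_iff.2 ⟨?_, ?_⟩
        · exact (Complex.continuous_ofReal.tendsto' 0 0 (by simp)).mono_left nhdsWithin_le_nhds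
        · filter_upwards [self_mem_nhdsWithin] with x hx
          simpa using hx
      exact h2.frequently h1
  refine Measure.ext_of_charFun (funext fun t => ?_)
  rw [← complexMGF_id_mul_I, ← complexMGF_id_mul_I]
  exact hEq ⟨by simpa using iμ, by simpa using iν⟩

/-! ### The method of moments -/

section MethodOfMoments

open Filter Topology

lemma abs_sub_clamp_le {M : ℝ} (hM : 0 < M) (v : ℝ) : |v - max (-M) (min v M)| ≤ v ^ 2 / M := by
  rw [le_div_iff₀ hM]
  rcases le_total v M with h | h
  · rw [min_eq_left h]
    rcases le_total (-M) v with h' | h'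
    · rw [max_eq_right h']; simp only [sub_self, abs_zero, zero_mul]; positivity
    · rw [max_eq_left h', abs_of_nonpos (by linarith)]; nlinarith
  · rw [min_eq_right h, max_eq_right (by linarith), abs_of_nonneg (by linarith)]; nlinarith

/-- Truncation of a continuous function to the interval `[-|M|, |M|]`. -/
def clampBCF (f : C(ℝ, ℝ)) (M : ℝ) : BoundedContinuousFunction ℝ ℝ :=
  BoundedContinuousFunction.ofNormedAddCommGroup (fun y => max (-|M|) (min (f y) |M|))
    (by fun_prop) |M| fun y => by
      rw [Real.norm_eq_abs, abs_le]
      exact ⟨le_max_left _ _, max_le (by linarith [abs_nonneg M]) (min_le_right _ _)⟩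

lemma clampBCF_apply (f : C(ℝ, ℝ)) {M : ℝ} (hM : 0 < M) (y : ℝ) :
    clampBCF f M y = max (-M) (min (f y) M) := by
  simp [clampBCF, abs_of_pos hM]

/-- Measures with uniformly bounded second moments are tight, by Chebyshev's inequality. -/
lemma isTightMeasureSet_of_integral_sq_le (C : ℝ) :
    IsTightMeasureSet {μ : Measure ℝ | Integrable (fun y : ℝ => y ^ 2) μ ∧ ∫ y, y ^ 2 ∂μ ≤ C} := by
  refine isTightMeasureSet_of_tendsto_measure_norm_gt ?_
  have hlim : Tendsto (fun r : ℝ => ENNReal.ofReal (C / r ^ 2)) atTop (𝓝 0) := by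
    rw [← ENNReal.ofReal_zero]
    exact ENNReal.tendsto_ofReal (tendsto_const_nhds.div_atTop (tendsto_pow_atTop two_ne_zero))
  refine tendsto_of_tendsto_of_tendsto_of_le_of_le' tendsto_const_nhds hlim
    (Eventually.of_forall fun _ => zero_le) ?_
  filter_upwards [eventually_gt_atTop 0] with r hr
  refine iSup₂_le fun μ hμ => ?_
  have h1 : ENNReal.ofReal (r ^ 2) * μ {x | r < ‖x‖} ≤ ENNReal.ofReal C := by
    calc ENNReal.ofReal (r ^ 2) * μ {x | r < ‖x‖}
        ≤ ENNReal.ofReal (r ^ 2) * μ {x | ENNReal.ofReal (r ^ 2) ≤ ENNReal.ofReal (x ^ 2)} := by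
          gcongr
          intro hx
          rw [Real.norm_eq_abs] at hx
          rw [← sq_abs x]
          gcongr
      _ ≤ ∫⁻ x, ENNReal.ofReal (x ^ 2) ∂μ := mul_meas_ge_le_lintegral (by fun_prop) _
      _ ≤ ENNReal.ofReal C := by
          rw [← ofReal_integral_eq_lintegral_ofReal hμ.1 (ae_of_all _ fun y => sq_nonneg y)]
          exact ENNReal.ofReal_le_ofReal hμ.2
  rw [ENNReal.ofReal_div_of_pos (by positivity)]
  rw [ENNReal.le_div_iff_mul_le (by left; positivity) (by left; finiteness), mul_comm]
  exact h1

/-- Along an ultrafilter, probability measures whose moments converge have a weak limit, whose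
moments are the limits of the moments. -/
theorem exists_tendsto_of_tendsto_moments {ι : Type*} (F : Ultrafilter ι)
    (μ : ι → ProbabilityMeasure ℝ) (hi : ∀ i, ∀ n : ℕ, Integrable (fun y : ℝ => y ^ n) (μ i))
    (m : ℕ → ℝ) (hm : ∀ n : ℕ, Tendsto (fun i => ∫ y, y ^ n ∂(μ i : Measure ℝ)) F (𝓝 (m n))) :
    ∃ ν : ProbabilityMeasure ℝ, Tendsto μ F (𝓝 ν) ∧
      (∀ n : ℕ, Integrable (fun y : ℝ => y ^ n) (ν : Measure ℝ)) ∧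
      ∀ n : ℕ, ∫ y, y ^ n ∂(ν : Measure ℝ) = m n := by
  obtain ⟨ν, hν⟩ : ∃ ν : ProbabilityMeasure ℝ, Tendsto μ F (𝓝 ν) := by
    set S : Set (ProbabilityMeasure ℝ) := {μ | Integrable (fun y : ℝ => y ^ 2) (μ : Measure ℝ) ∧
      ∫ y, y ^ 2 ∂(μ : Measure ℝ) ≤ m 2 + 1} with hS
    have hc : IsCompact (closure S) := by
      refine isCompact_closure_of_isTightMeasureSet
        ((isTightMeasureSet_of_integral_sq_le (m 2 + 1)).subset ?_)
      rintro _ ⟨ρ, hρ, rfl⟩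
      exact hρ
    have hev : ∀ᶠ i in (F : Filter ι), μ i ∈ closure S := by
      filter_upwards [(hm 2).eventually (eventually_le_nhds (b := m 2 + 1) (by linarith))] with i h
      exact subset_closure ⟨hi i 2, h⟩
    obtain ⟨ν, -, hν⟩ := hc.ultrafilter_le_nhds (F.map μ) (by
      rw [le_principal_iff]; exact hev)
    exact ⟨ν, hν⟩
  have hbdd := ProbabilityMeasure.tendsto_iff_forall_integral_tendsto.1 hν
  let P : ℕ → C(ℝ, ℝ) := fun n => ⟨fun y => y ^ n, by fun_prop⟩
  have hint : ∀ n, Integrable (fun y : ℝ => y ^ (n + n)) (ν : Measure ℝ) := by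
    intro n
    have hpos : ∀ y : ℝ, 0 ≤ y ^ (n + n) := fun y => Even.pow_nonneg ⟨n, rfl⟩ y
    have hle : ∀ M : ℕ, ∫ y, clampBCF (P (n + n)) (M + 1) y ∂(ν : Measure ℝ) ≤ m (n + n) := by
      intro M
      refine le_of_tendsto_of_tendsto (hbdd (clampBCF (P (n + n)) (M + 1))) (hm (n + n))
        (Eventually.of_forall fun i => ?_)
      refine integral_mono (BoundedContinuousFunction.integrable _ _) (hi i _) fun y => ?_
      rw [clampBCF_apply _ (by positivity)]
      exact max_le (by have := hpos y; simp only; have : (0:ℝ) < (M : ℝ) + 1 := by positivity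
                       linarith) (min_le_left _ _)
    refine ⟨by fun_prop, ?_⟩
    rw [hasFiniteIntegral_iff_ofReal (ae_of_all _ hpos)]
    -- Fatou's lemma, applied to the truncations at the heights `M + 1`
    have hF : ∀ y : ℝ, ENNReal.ofReal (y ^ (n + n))
        = liminf (fun M : ℕ => ENNReal.ofReal (clampBCF (P (n + n)) (M + 1) y)) atTop := by
      intro y
      symm
      refine Tendsto.liminf_eq (tendsto_const_nhds.congr' ?_)
      filter_upwards [eventually_ge_atTop ⌈y ^ (n + n)⌉₊] with M hM
      have h1 := Nat.ceil_le.1 hM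
      have h2 := hpos y
      rw [clampBCF_apply _ (by positivity), min_eq_left, max_eq_right]
      · rfl
      · change -((M : ℝ) + 1) ≤ y ^ (n + n); linarith
      · change y ^ (n + n) ≤ (M : ℝ) + 1; linarith
    simp only [hF]
    refine (lintegral_liminf_le fun M => ?_).trans_lt ?_
    · exact ((clampBCF (P (n + n)) (M + 1)).continuous.measurable).ennreal_ofReal
    · refine lt_of_le_of_lt (b := ENNReal.ofReal (m (n + n))) ?_ ENNReal.ofReal_lt_top
      refine (liminf_le_liminf (v := fun _ => ENNReal.ofReal (m (n + n)))
        (Eventually.of_forall fun M => ?_)).trans (by simp)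
      rw [← ofReal_integral_eq_lintegral_ofReal (BoundedContinuousFunction.integrable _ _)]
      · exact ENNReal.ofReal_le_ofReal (hle M)
      · refine ae_of_all _ fun y => ?_
        have := hpos y
        rw [clampBCF_apply _ (by positivity)]
        exact le_max_of_le_right (le_min this (by positivity))
  have hint' : ∀ n : ℕ, Integrable (fun y : ℝ => y ^ n) (ν : Measure ℝ) := by
    intro n
    refine ((hint n).add (integrable_const 1)).mono' (by fun_prop) (ae_of_all _ fun y => ?_)
    simp only [Pi.add_apply, Real.norm_eq_abs, pow_add]
    rw [← abs_mul_abs_self (y ^ n)]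
    nlinarith [sq_nonneg (|y ^ n| - 1), abs_nonneg (y ^ n)]
  refine ⟨ν, hν, hint', fun n => ?_⟩
  -- replacing `y ^ n` by its truncation at height `M` costs at most `∫ y ^ (2 n) / M`
  have trunc : ∀ (ρ : ProbabilityMeasure ℝ) (M : ℝ), 0 < M →
      (∀ k : ℕ, Integrable (fun y : ℝ => y ^ k) (ρ : Measure ℝ)) →
      |∫ y, y ^ n ∂(ρ : Measure ℝ) - ∫ y, clampBCF (P n) M y ∂(ρ : Measure ℝ)|
        ≤ (∫ y, y ^ (n + n) ∂(ρ : Measure ℝ)) / M := by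
    intro ρ M hM hρ
    rw [← integral_sub (hρ n) (BoundedContinuousFunction.integrable _ _), ← integral_div]
    refine (abs_integral_le_integral_abs).trans (integral_mono ?_ ((hρ _).div_const _) fun y => ?_)
    · exact ((hρ n).sub (BoundedContinuousFunction.integrable _ _)).abs
    · change |y ^ n - clampBCF (P n) M y| ≤ y ^ (n + n) / M
      rw [clampBCF_apply _ hM, pow_add, ← sq]
      exact abs_sub_clamp_le hM _
  have key : ∀ M : ℝ, 0 < M → |∫ y, y ^ n ∂(ν : Measure ℝ) - m n|
      ≤ (∫ y, y ^ (n + n) ∂(ν : Measure ℝ) + m (n + n)) / M := by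
    intro M hM
    have h1 := trunc ν M hM hint'
    have h2 : |m n - ∫ y, clampBCF (P n) M y ∂(ν : Measure ℝ)| ≤ m (n + n) / M :=
      le_of_tendsto_of_tendsto (((hm n).sub (hbdd (clampBCF (P n) M))).abs)
        ((hm (n + n)).div_const M) (Eventually.of_forall fun i => trunc (μ i) M hM (hi i))
    rw [add_div]
    have := abs_sub_le (∫ y, y ^ n ∂(ν : Measure ℝ)) (∫ y, clampBCF (P n) M y ∂(ν : Measure ℝ)) (m n)
    rw [abs_sub_comm (m n)] at h2
    linarith
  have hlim : Tendsto (fun M : ℝ => (∫ y, y ^ (n + n) ∂(ν : Measure ℝ) + m (n + n)) / M) atTop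
      (𝓝 0) := tendsto_const_nhds.div_atTop tendsto_id
  have := ge_of_tendsto hlim ((eventually_gt_atTop 0).mono fun M hM => key M hM)
  exact sub_eq_zero.1 (abs_nonpos_iff.1 this)

end MethodOfMoments

/-! ### Favard's theorem in the determinate case -/

namespace IsThreeTermRecurrence

variable {Q : ℕ → ℝ[X]} {a b : ℕ → ℝ}

lemma integral_pow_of_isOrthogonalityMeasure (h : IsThreeTermRecurrence Q a b) {μ : Measure ℝ}
    (hμ : IsOrthogonalityMeasure Q μ) (n : ℕ) : ∫ y, y ^ n ∂μ = recurrenceCoeff a b n 0 := by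
  have := hμ.isProbabilityMeasure
  refine h.integral_pow hμ.integrable_pow fun j hj _ => ?_
  have := hμ.orthogonal j 0 (by omega)
  simpa [h.zero] using this

/-- Favard's theorem: the weak limit of Gauss quadratures is an orthogonality measure. -/
theorem exists_isOrthogonalityMeasure (h : IsThreeTermRecurrence Q a b) (hb : ∀ n, 0 ≤ b n) :
    ∃ μ, IsOrthogonalityMeasure Q μ := by
  choose μ hμ hi ho using h.exists_quadrature hb
  have hm : ∀ n N, n ≤ N → ∫ y, y ^ n ∂(μ N) = recurrenceCoeff a b n 0 := by
    intro n N hn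
    have := hμ N
    refine h.integral_pow (hi N) fun j hj hjn => ?_
    have := ho N j 0 (by omega) (by omega) (by omega)
    simpa [h.zero] using this
  obtain ⟨ν, -, hν, hν'⟩ := exists_tendsto_of_tendsto_moments (Filter.hyperfilter ℕ)
    (fun N => ⟨μ N, hμ N⟩) hi (fun n => recurrenceCoeff a b n 0) (fun n => by
      refine Filter.Tendsto.mono_left ?_ (Nat.hyperfilter_le_atTop)
      refine tendsto_const_nhds.congr' ?_
      filter_upwards [Filter.eventually_ge_atTop n] with N hN
      exact (hm n N hN).symm)
  refine ⟨ν, inferInstance, hν, fun m n hmn => ?_⟩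
  -- `N` is so large that the first `N + 1` moments decide the integral of `Q m * Q n`.
  set N := m + n + (Q m * Q n).natDegree with hN
  rw [← ho N m n (by omega) (by omega) hmn]
  simp only [← Polynomial.eval_mul]
  rw [integral_eval hν, integral_eval (hi N)]
  refine Finset.sum_congr rfl fun i hin => ?_
  rw [hν', hm i N (by rw [Finset.mem_range] at hin; omega)]

/-- Determinacy. For uniqueness it is enough that `Q_1, Q_2, …` are orthogonal to the constants. -/
theorem eq_of_integral_eq_zero (h : IsThreeTermRecurrence Q a b) {A : ℝ}
    (ha : ∀ j, |a j| ≤ A * (j + 1)) (hb : ∀ j, |b j| ≤ A * (j + 1) ^ 2) {μ ν : Measure ℝ}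
    (hμ : IsOrthogonalityMeasure Q μ) [IsProbabilityMeasure ν]
    (hν : ∀ n : ℕ, Integrable (fun y : ℝ => y ^ n) ν)
    (hν' : ∀ n, 1 ≤ n → ∫ y, (Q n).eval y ∂ν = 0) : ν = μ := by
  have := hμ.isProbabilityMeasure
  have hA : 0 ≤ A := by
    have := (abs_nonneg _).trans (ha 0); simpa using this
  refine eq_of_integral_pow_eq hμ.integrable_pow hν (K := 1 + 2 * A) (by positivity) (fun n => ?_)
    fun n => ?_
  · rw [h.integral_pow_of_isOrthogonalityMeasure hμ]
    simpa using abs_recurrenceCoeff_le ha hb n 0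
  · rw [h.integral_pow_of_isOrthogonalityMeasure hμ, h.integral_pow hν fun j hj _ => hν' j hj]

end IsThreeTermRecurrence

open Filter Topology in
/-- If the recurrence coefficients depend continuously on a parameter, then so do the (unique)
orthogonality measures, in the topology of weak convergence. -/
theorem continuous_isOrthogonalityMeasure {X : Type*} [TopologicalSpace X] {Q : X → ℕ → ℝ[X]}
    {a b : X → ℕ → ℝ} (h : ∀ x, IsThreeTermRecurrence (Q x) (a x) (b x))
    (ha : ∀ j, Continuous fun x => a x j) (hb : ∀ j, Continuous fun x => b x j) {A : X → ℝ}
    (ha' : ∀ x j, |a x j| ≤ A x * (j + 1)) (hb' : ∀ x j, |b x j| ≤ A x * (j + 1) ^ 2)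
    {μ : X → ProbabilityMeasure ℝ} (hμ : ∀ x, IsOrthogonalityMeasure (Q x) (μ x : Measure ℝ)) :
    Continuous μ := by
  refine continuous_iff_continuousAt.2 fun x => ?_
  refine (tendsto_iff_ultrafilter _ _ _).2 fun F hF => ?_
  have hc : ∀ n, Tendsto (fun x' => ∫ y, y ^ n ∂(μ x' : Measure ℝ)) F
      (𝓝 (∫ y, y ^ n ∂(μ x : Measure ℝ))) := by
    intro n
    simp only [fun x' => (h x').integral_pow_of_isOrthogonalityMeasure (hμ x')]
    exact ((continuous_recurrenceCoeff ha hb n 0).tendsto x).mono_left hF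
  obtain ⟨ν, hν, hi, hm⟩ := exists_tendsto_of_tendsto_moments F μ
    (fun x' => (hμ x').integrable_pow) _ hc
  have heq : (ν : Measure ℝ) = μ x := by
    refine (h x).eq_of_integral_eq_zero (ha' x) (hb' x) (hμ x) hi fun n hn => ?_
    rw [integral_eval hi]
    simp only [hm]
    rw [← integral_eval (hμ x).integrable_pow]
    have := (hμ x).orthogonal n 0 (by omega)
    simpa [(h x).zero] using this
  rwa [Subtype.ext heq] at hν

open Filter Topology in
/-- Weakly continuous families are measurable families: on open sets the mass is lower
semicontinuous by the portmanteau theorem. -/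
lemma measurable_coe_of_continuous {X : Type*} [TopologicalSpace X] [MeasurableSpace X]
    [OpensMeasurableSpace X] {μ : X → ProbabilityMeasure ℝ} (hμ : Continuous μ) :
    Measurable fun x => (μ x : Measure ℝ) := by
  refine Measurable.measure_of_isPiSystem_of_isProbabilityMeasure (S := {s : Set ℝ | IsOpen s})
    BorelSpace.measurable_eq isPiSystem_isOpen fun G hG => ?_
  have : LowerSemicontinuous fun x => (μ x : Measure ℝ) G :=
    lowerSemicontinuous_iff_le_liminf.2 fun x =>
      ProbabilityMeasure.le_liminf_measure_open_of_tendsto (hμ.tendsto x) hG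
  exact this.measurable

/-! ### The measures of the `q`-Meixner polynomials -/

lemma qNumber_succ (q : ℝ) (n : ℕ) : qNumber q (n + 1) = 1 + q * qNumber q n := by
  have := qNumber_add q n 1
  simpa [qNumber_one] using this

lemma qNumber_nonneg {q : ℝ} (hq : -1 ≤ q) (n : ℕ) : 0 ≤ qNumber q n := by
  rcases le_total 0 q with h | h
  · exact Finset.sum_nonneg fun i _ => pow_nonneg h i
  · have : 0 ≤ qNumber q n ∧ qNumber q n ≤ 1 := by
      induction n with
      | zero => simp [qNumber_zero]
      | succ n ih =>
        rw [qNumber_succ]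
        constructor <;> nlinarith
    exact this.1

lemma qNumber_le {q : ℝ} (hq : |q| ≤ 1) (n : ℕ) : qNumber q n ≤ n := by
  calc qNumber q n ≤ ∑ i ∈ Finset.range n, (1 : ℝ) :=
        Finset.sum_le_sum fun i _ => (le_abs_self _).trans <| by
          rw [abs_pow]; exact pow_le_one₀ (abs_nonneg q) hq
    _ = n := by simp

lemma qMeixnerPoly_isThreeTermRecurrence (q θ τ x s t : ℝ) :
    IsThreeTermRecurrence (qMeixnerPoly q θ τ x s t) (fun n => θ * qNumber q n + x * q ^ n)
      (fun n => (t - s * q ^ n + τ * qNumber q n) * qNumber q (n + 1)) where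
  zero := rfl
  one := by simp [qMeixnerPoly_one, qNumber_zero]
  add_two _ := rfl

lemma sub_mul_pow_nonneg {q s t : ℝ} (hq : |q| ≤ 1) (hs : 0 ≤ s) (hst : s < t) (n : ℕ) :
    0 ≤ t - s * q ^ n ∧ t - s * q ^ n ≤ t + s := by
  have h1 : |q ^ n| ≤ 1 := by rw [abs_pow]; exact pow_le_one₀ (abs_nonneg q) hq
  have := abs_le.1 h1
  constructor <;> nlinarith

lemma qMeixner_coeff_nonneg {q τ s t : ℝ} (hq : |q| ≤ 1) (hτ : 0 ≤ τ) (hs : 0 ≤ s) (hst : s < t)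
    (n : ℕ) : 0 ≤ (t - s * q ^ n + τ * qNumber q n) * qNumber q (n + 1) := by
  have h1 := qNumber_nonneg (abs_le.1 hq).1 n
  have h2 := qNumber_nonneg (abs_le.1 hq).1 (n + 1)
  have h3 := (sub_mul_pow_nonneg hq hs hst n).1
  positivity

lemma abs_qMeixner_coeff_le {q θ τ s t : ℝ} (hq : |q| ≤ 1) (hτ : 0 ≤ τ) (hs : 0 ≤ s) (hst : s < t)
    (x : ℝ) (n : ℕ) :
    |θ * qNumber q n + x * q ^ n| ≤ (|θ| + |x| + (t + s + τ)) * (n + 1) ∧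
    |(t - s * q ^ n + τ * qNumber q n) * qNumber q (n + 1)|
      ≤ (|θ| + |x| + (t + s + τ)) * (n + 1) ^ 2 := by
  have h1 := qNumber_nonneg (abs_le.1 hq).1 n
  have h2 := qNumber_nonneg (abs_le.1 hq).1 (n + 1)
  have h3 := sub_mul_pow_nonneg hq hs hst n
  have h4 := qNumber_le hq n
  have h5 := qNumber_le hq (n + 1)
  push_cast at h5
  have h6 : |q ^ n| ≤ 1 := by rw [abs_pow]; exact pow_le_one₀ (abs_nonneg q) hq
  have hθ := abs_nonneg θ
  have hx := abs_nonneg x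
  have ht : 0 < t := hs.trans_lt hst
  have hn : (0 : ℝ) ≤ n := Nat.cast_nonneg n
  constructor
  · calc |θ * qNumber q n + x * q ^ n| ≤ |θ| * qNumber q n + |x| * |q ^ n| := by
          refine (abs_add_le _ _).trans ?_
          rw [abs_mul, abs_mul, abs_of_nonneg h1]
      _ ≤ |θ| * (n + 1) + |x| * (n + 1) := by gcongr <;> linarith
      _ ≤ (|θ| + |x| + (t + s + τ)) * (n + 1) := by
          have : 0 ≤ (t + s + τ) * ((n : ℝ) + 1) := by positivity
          linarith
  · rw [abs_of_nonneg (qMeixner_coeff_nonneg hq hτ hs hst n)]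
    calc (t - s * q ^ n + τ * qNumber q n) * qNumber q (n + 1)
        ≤ ((t + s) * (n + 1) + τ * (n + 1)) * (n + 1) := by
          have : 0 ≤ (t + s) * (n : ℝ) := by positivity
          have : τ * qNumber q n ≤ τ * (n + 1) := by gcongr; linarith
          have := mul_nonneg hτ h1
          gcongr
          linarith [h3.2]
      _ ≤ (|θ| + |x| + (t + s + τ)) * (n + 1) ^ 2 := by
          have : 0 ≤ (|θ| + |x|) * ((n : ℝ) + 1) ^ 2 := by positivity
          linarith

lemma qMeixnerMeasure_isOrthogonalityMeasure {q τ s t : ℝ} (hq : |q| ≤ 1) (hτ : 0 ≤ τ)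
    (hs : 0 ≤ s) (hst : s < t) (θ x : ℝ) :
    IsOrthogonalityMeasure (qMeixnerPoly q θ τ x s t) (qMeixnerMeasure q θ τ x s t) :=
  Classical.epsilon_spec ((qMeixnerPoly_isThreeTermRecurrence q θ τ x s t).exists_isOrthogonalityMeasure
    (qMeixner_coeff_nonneg hq hτ hs hst))

lemma eq_qMeixnerMeasure {q τ s t : ℝ} (hq : |q| ≤ 1) (hτ : 0 ≤ τ)
    (hs : 0 ≤ s) (hst : s < t) (θ x : ℝ) {ν : Measure ℝ} [IsProbabilityMeasure ν]
    (hν : ∀ n : ℕ, Integrable (fun y : ℝ => y ^ n) ν)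
    (hν' : ∀ n, 1 ≤ n → ∫ y, (qMeixnerPoly q θ τ x s t n).eval y ∂ν = 0) :
    ν = qMeixnerMeasure q θ τ x s t :=
  (qMeixnerPoly_isThreeTermRecurrence q θ τ x s t).eq_of_integral_eq_zero
    (fun j => (abs_qMeixner_coeff_le hq hτ hs hst x j).1)
    (fun j => (abs_qMeixner_coeff_le hq hτ hs hst x j).2)
    (qMeixnerMeasure_isOrthogonalityMeasure hq hτ hs hst θ x) hν hν'

lemma integral_qMeixnerPoly {q τ s t : ℝ} (hq : |q| ≤ 1) (hτ : 0 ≤ τ)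
    (hs : 0 ≤ s) (hst : s < t) (θ x : ℝ) (n : ℕ) :
    ∫ y, (qMeixnerPoly q θ τ x s t n).eval y ∂(qMeixnerMeasure q θ τ x s t)
      = if n = 0 then 1 else 0 := by
  have h := qMeixnerMeasure_isOrthogonalityMeasure hq hτ hs hst θ x
  have := h.isProbabilityMeasure
  split_ifs with hn
  · subst hn; simp [qMeixnerPoly_zero]
  · have := h.orthogonal n 0 hn
    simpa [qMeixnerPoly_zero] using this

lemma measurable_qMeixnerMeasure {q τ s t : ℝ} (hq : |q| ≤ 1) (hτ : 0 ≤ τ)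
    (hs : 0 ≤ s) (hst : s < t) (θ : ℝ) : Measurable fun x => qMeixnerMeasure q θ τ x s t := by
  have h := qMeixnerMeasure_isOrthogonalityMeasure hq hτ hs hst θ
  exact measurable_coe_of_continuous (continuous_isOrthogonalityMeasure
    (μ := fun x => ⟨qMeixnerMeasure q θ τ x s t, (h x).isProbabilityMeasure⟩)
    (fun x => qMeixnerPoly_isThreeTermRecurrence q θ τ x s t) (fun j => by fun_prop)
    (fun j => by fun_prop) (fun x j => (abs_qMeixner_coeff_le hq hτ hs hst x j).1)
    (fun x j => (abs_qMeixner_coeff_le hq hτ hs hst x j).2) h)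

/-! ### The Chapman-Kolmogorov equation -/

lemma exists_recurrenceCoeff_eq_eval {a : ℝ → ℕ → ℝ} {b : ℕ → ℝ}
    (ha : ∀ j, ∃ p : ℝ[X], ∀ x, a x j = p.eval x) (n : ℕ) :
    ∀ j, ∃ p : ℝ[X], ∀ x, recurrenceCoeff (a x) b n j = p.eval x := by
  choose p hp using ha
  induction n with
  | zero => exact fun j => ⟨Polynomial.C (if j = 0 then 1 else 0), fun x => by
      simp only [recurrenceCoeff, Polynomial.eval_C]⟩
  | succ n ih =>
    choose r hr using ih
    intro j
    rcases j with _ | j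
    · exact ⟨p 0 * r 0 + Polynomial.C (b 0) * r 1, by simp [recurrenceCoeff, hp, hr]⟩
    · exact ⟨r j + p (j + 1) * r (j + 1) + Polynomial.C (b (j + 1)) * r (j + 2),
        by simp [recurrenceCoeff, hp, hr]⟩

/-- The moments of `μ_{y,t,u}` are polynomials in `y`. -/
lemma exists_integral_pow_qMeixnerMeasure {q τ t u : ℝ} (hq : |q| ≤ 1) (hτ : 0 ≤ τ)
    (ht : 0 ≤ t) (htu : t < u) (θ : ℝ) (n : ℕ) :
    ∃ p : ℝ[X], ∀ y, ∫ z, z ^ n ∂(qMeixnerMeasure q θ τ y t u) = p.eval y := by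
  obtain ⟨p, hp⟩ := exists_recurrenceCoeff_eq_eval (a := fun y n => θ * qNumber q n + y * q ^ n)
    (b := fun n => (u - t * q ^ n + τ * qNumber q n) * qNumber q (n + 1))
    (fun j => ⟨Polynomial.C (θ * qNumber q j) + Polynomial.X * Polynomial.C (q ^ j), by simp⟩) n 0
  exact ⟨p, fun y => by
    rw [← hp]
    exact (qMeixnerPoly_isThreeTermRecurrence q θ τ y t u).integral_pow_of_isOrthogonalityMeasure
      (qMeixnerMeasure_isOrthogonalityMeasure hq hτ ht htu θ y) n⟩

/-- The kernel `x ↦ μ_{x,s,t}`, from its measurability. -/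
noncomputable def qMeixnerKernel (q θ τ s t : ℝ)
    (h : Measurable fun x => qMeixnerMeasure q θ τ x s t) : Kernel ℝ ℝ where
  toFun x := qMeixnerMeasure q θ τ x s t
  measurable' := h

/-- The Chapman-Kolmogorov equation. By the convolution identity the integral of
`Q_n(· | x, s, u)` against `μ_{y,t,u}` is `Q_n(y | x, s, t)`, because all terms but one are
annihilated; the integral of the latter against `μ_{x,s,t}` vanishes for `n ≥ 1`. -/
theorem bind_qMeixnerMeasure {q τ s t u : ℝ} (hq : |q| ≤ 1) (hτ : 0 ≤ τ) (hs : 0 ≤ s)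
    (hst : s < t) (htu : t < u) (θ x : ℝ) :
    (qMeixnerMeasure q θ τ x s t).bind (fun y => qMeixnerMeasure q θ τ y t u)
      = qMeixnerMeasure q θ τ x s u := by
  have ht : 0 ≤ t := hs.trans hst.le
  set κ := qMeixnerKernel q θ τ t u (measurable_qMeixnerMeasure hq hτ ht htu θ) with hκ
  set μ := qMeixnerMeasure q θ τ x s t with hμdef
  have hμ : IsOrthogonalityMeasure _ μ := qMeixnerMeasure_isOrthogonalityMeasure hq hτ hs hst θ x
  have hκy : ∀ y, IsOrthogonalityMeasure (qMeixnerPoly q θ τ y t u) (κ y) := fun y =>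
    qMeixnerMeasure_isOrthogonalityMeasure hq hτ ht htu θ y
  have := hμ.isProbabilityMeasure
  have hmk : IsMarkovKernel κ := ⟨fun y => (hκy y).isProbabilityMeasure⟩
  change μ.bind κ = _
  have hint : ∀ n : ℕ, Integrable (fun z : ℝ => z ^ n) (μ.bind κ) := by
    intro n
    rw [Measure.integrable_comp_iff (by fun_prop)]
    refine ⟨ae_of_all _ fun y => (hκy y).integrable_pow n, ?_⟩
    -- `|z| ^ n ≤ z ^ (2 n) + 1`, and the even moments of `μ_{y,t,u}` are polynomials in `y`
    obtain ⟨p, hp⟩ := exists_integral_pow_qMeixnerMeasure hq hτ ht htu θ (n + n)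
    refine ((integrable_eval hμ.integrable_pow p).add (integrable_const 1)).mono'
      (StronglyMeasurable.integral_kernel (by fun_prop)).aestronglyMeasurable
      (ae_of_all _ fun y => ?_)
    have hy := hκy y
    rw [Real.norm_of_nonneg (integral_nonneg fun z => norm_nonneg _), Pi.add_apply, ← hp]
    have h1 : ∫ z, (z ^ (n + n) + 1) ∂(κ y) = ∫ z, z ^ (n + n) ∂(κ y) + 1 := by
      rw [integral_add (hy.integrable_pow _) (integrable_const _)]
      simp
    refine le_trans (integral_mono (hy.integrable_pow n).norm
      ((hy.integrable_pow (n + n)).add (integrable_const 1)) fun z => ?_) h1.le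
    change ‖z ^ n‖ ≤ z ^ (n + n) + 1
    rw [Real.norm_eq_abs, pow_add, ← abs_mul_abs_self (z ^ n)]
    nlinarith [sq_nonneg (|z ^ n| - 1), abs_nonneg (z ^ n)]
  refine eq_qMeixnerMeasure hq hτ hs (hst.trans htu) θ x hint fun n hn => ?_
  have hcomp := Kernel.integral_comp (κ := Kernel.const Unit μ) (η := κ) (a := ())
    (f := fun z => (qMeixnerPoly q θ τ x s u n).eval z)
    (by rw [← Measure.comp_eq_comp_const_apply]; exact integrable_eval hint _)
  rw [← Measure.comp_eq_comp_const_apply, Kernel.const_apply] at hcomp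
  rw [hcomp]
  -- Only the term with `p.2 = 0` of the convolution identity survives.
  have h1 : ∀ y, ∫ z, (qMeixnerPoly q θ τ x s u n).eval z ∂(κ y)
      = (qMeixnerPoly q θ τ x s t n).eval y := by
    intro y
    have hy := hκy y
    simp only [eval_qMeixnerPoly_eq_sum q θ τ x s t u y]
    rw [integral_finsetSum _ fun p _ => ((integrable_eval hy.integrable_pow _).const_mul _).const_mul _,
      Finset.sum_eq_single (n, 0)]
    · simp only [integral_const_mul, qBinomial_zero_right]
      have := integral_qMeixnerPoly hq hτ ht htu θ y 0
      rw [if_pos rfl] at this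
      change 1 * (_ * ∫ z, _ ∂(qMeixnerMeasure q θ τ y t u)) = _
      rw [this]; ring
    · rintro ⟨i, j⟩ hij hne
      rw [Finset.HasAntidiagonal.mem_antidiagonal] at hij
      have hj : j ≠ 0 := by
        rintro rfl
        exact hne (by simp at hij; rw [hij])
      have := integral_qMeixnerPoly hq hτ ht htu θ y j
      rw [if_neg hj] at this
      simp only [integral_const_mul]
      change _ * (_ * ∫ z, _ ∂(qMeixnerMeasure q θ τ y t u)) = _
      rw [this]; ring
    · intro h; exact absurd (by simp) h
  simp only [h1]
  rw [integral_qMeixnerPoly hq hτ hs hst θ x n, if_neg (by omega)]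

/-! ### Kolmogorov's extension theorem -/

open Filter Topology Set in
/-- The content defined by a projective family on a power of a Polish space is continuous at `∅`. By
inner regularity a decreasing sequence of cylinders with content bounded below contains cylinders
with compact bases, finitely many of which always have a common point; a limit of such points along
an ultrafilter, taken coordinate by coordinate, belongs to all of them. -/
lemma tendsto_projectiveFamilyContent_zero {ι E : Type*} [TopologicalSpace E] [PolishSpace E]
    [Nonempty E] [MeasurableSpace E] [BorelSpace E] {P : ∀ J : Finset ι, Measure (J → E)}
    [∀ J, IsProbabilityMeasure (P J)]
    (hP : IsProjectiveMeasureFamily (α := fun _ => E) P) {B : ℕ → Set (ι → E)}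
    (hB : ∀ n, B n ∈ measurableCylinders fun _ : ι => E) (hanti : Antitone B)
    (hempty : ⋂ n, B n = ∅) :
    Tendsto (fun n => projectiveFamilyContent hP (B n)) atTop (𝓝 0) := by
  choose I S hS hBS using fun n => (mem_measurableCylinders (B n)).1 (hB n)
  have hring : IsSetRing (measurableCylinders fun _ : ι => E) := isSetRing_measurableCylinders
  rw [ENNReal.tendsto_atTop_zero]
  intro ε hε
  by_contra! hcon
  have hlow : ∀ n, ε < projectiveFamilyContent hP (B n) := by
    intro n
    obtain ⟨m, hm, hlt⟩ := hcon n
    exact hlt.trans_le (projectiveFamilyContent_mono hP (hB m) (hB n) (hanti hm))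
  obtain ⟨δ, hδ, hsum⟩ := ENNReal.exists_pos_sum_of_countable hε.ne' ℕ
  have hK : ∀ n, ∃ K ⊆ S n, IsCompact K ∧ P (I n) (S n \ K) < δ n := fun n =>
    (hS n).exists_isCompact_sdiff_lt (measure_ne_top _ _) (by simpa using (hδ n).ne')
  choose K hKS hKc hKm using hK
  set C : ℕ → Set (ι → E) := fun n => cylinder (α := fun _ => E) (I n) (K n) with hC
  have hCmem : ∀ n, C n ∈ measurableCylinders fun _ : ι => E := fun n =>
    cylinder_mem_measurableCylinders _ _ (hKc n).measurableSet
  have hdiff : ∀ n, projectiveFamilyContent hP (B n \ C n) ≤ δ n := by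
    intro n
    have e : B n \ C n = cylinder (α := fun _ => E) (I n) (S n \ K n) := by
      rw [hBS n]; rfl
    rw [projectiveFamilyContent_congr hP _ e ((hS n).diff (hKc n).measurableSet)]
    exact (hKm n).le
  -- `B n` is not covered by the `B k \ C k`, whose contents sum to less than `ε`
  have hne : ∀ n, ∃ y : ι → E, ∀ k ≤ n, y ∈ C k := by
    intro n
    by_contra! hno
    have hsub : B n ⊆ ⋃ k ∈ Finset.range (n + 1), B k \ C k := by
      intro y hy
      obtain ⟨k, hk, hyk⟩ := hno y
      simp only [mem_iUnion]
      exact ⟨k, Finset.mem_range.2 (by omega), hanti hk hy, hyk⟩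
    have hmem : ∀ k ∈ Finset.range (n + 1), B k \ C k ∈ measurableCylinders fun _ : ι => E :=
      fun k _ => hring.sdiff_mem (hB k) (hCmem k)
    have h1 : projectiveFamilyContent hP (B n)
        ≤ ∑ k ∈ Finset.range (n + 1), projectiveFamilyContent hP (B k \ C k) :=
      (projectiveFamilyContent_mono hP (hB n) (hring.biUnion_mem _ hmem) hsub).trans
        (addContent_biUnion_le hring hmem)
    have h2 : ∑ k ∈ Finset.range (n + 1), projectiveFamilyContent hP (B k \ C k)
        ≤ ∑' k, (δ k : ENNReal) :=
      (Finset.sum_le_sum fun k _ => hdiff k).trans (ENNReal.sum_le_tsum _)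
    exact absurd (hlow n) (not_lt.2 ((h1.trans h2).trans hsum.le))
  choose y hy using hne
  set x : ι → E := fun i => limUnder (hyperfilter ℕ : Filter ℕ) fun m => y m i with hx
  have hxC : ∀ n, x ∈ C n := by
    intro n
    obtain ⟨z, hz, hlim⟩ := (hKc n).ultrafilter_le_nhds
      ((hyperfilter ℕ).map fun m => (I n).restrict (π := fun _ => E) (y m)) (by
        rw [le_principal_iff]
        refine Nat.hyperfilter_le_atTop ?_
        filter_upwards [eventually_ge_atTop n] with m hm
        exact hy m n hm)
    have hz' : Tendsto (fun m => (I n).restrict (π := fun _ => E) (y m)) (hyperfilter ℕ) (𝓝 z) := hlim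
    have : (I n).restrict (π := fun _ => E) x = z := by
      funext i
      exact ((tendsto_pi_nhds.1 hz') i).limUnder_eq
    change (I n).restrict (π := fun _ => E) x ∈ K n
    rwa [this]
  have : x ∈ ⋂ n, B n := mem_iInter.2 fun n => by
    rw [hBS n]
    exact hKS n (hxC n)
  rw [hempty] at this
  exact this

/-- Kolmogorov's extension theorem for powers of a Polish space, over an arbitrary index set. -/
theorem exists_isProjectiveLimit {ι E : Type*} [TopologicalSpace E] [PolishSpace E]
    [Nonempty E] [MeasurableSpace E] [BorelSpace E] {P : ∀ J : Finset ι, Measure (J → E)}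
    [∀ J, IsProbabilityMeasure (P J)] (hP : IsProjectiveMeasureFamily (α := fun _ => E) P) :
    ∃ μ : Measure (ι → E), IsProjectiveLimit μ P := by
  have hσ : (projectiveFamilyContent hP).IsSigmaSubadditive := by
    refine isSigmaSubadditive_of_addContent_iUnion_eq_tsum isSetRing_measurableCylinders
      fun f hf hf_Union hf' => ?_
    exact addContent_iUnion_eq_sum_of_tendsto_zero isSetRing_measurableCylinders
      (projectiveFamilyContent hP) (fun s _ => projectiveFamilyContent_ne_top hP)
      (fun _ h1 h2 h3 => tendsto_projectiveFamilyContent_zero hP h1 h2 h3) hf hf_Union hf'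
  refine ⟨(projectiveFamilyContent hP).measure isSetSemiring_measurableCylinders
    generateFrom_measurableCylinders.ge hσ, fun I => ?_⟩
  ext s hs
  rw [Measure.map_apply (Finset.measurable_restrict I) hs, AddContent.measure_eq, ← cylinder,
    projectiveFamilyContent_cylinder hP hs]
  · exact generateFrom_measurableCylinders.symm
  · exact cylinder_mem_measurableCylinders _ _ hs

/-! ### Finite-dimensional laws of a Markov process -/

section PathLaw

variable {T : Type*} [LinearOrder T]

/-- The law of the path that visits, at the times of the list `l`, the successive states of the
Markov chain with transition kernels `K`, started from a given state at time `s`. The coordinates at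
all other times are `0`. -/
noncomputable def pathLaw (K : T → T → Kernel ℝ ℝ) : List T → T → Kernel ℝ (T → ℝ)
  | [], _ => Kernel.const ℝ (Measure.dirac 0)
  | t :: l, s => ((K s t) ⊗ₖ (Kernel.prodMkLeft ℝ (pathLaw K l t))).map
      fun p => Function.update p.2 t p.1

lemma measurable_update_prod (t : T) :
    Measurable fun p : ℝ × (T → ℝ) => Function.update p.2 t p.1 := by
  refine measurable_pi_lambda _ fun r => ?_
  by_cases h : r = t
  · subst h; simpa using measurable_fst
  · simp only [Function.update_of_ne h]; fun_prop

variable (K : T → T → Kernel ℝ ℝ) [∀ s t, IsMarkovKernel (K s t)]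

instance isMarkovKernel_pathLaw (l : List T) : ∀ s, IsMarkovKernel (pathLaw K l s) := by
  induction l with
  | nil => intro s; unfold pathLaw; infer_instance
  | cons t l ih =>
    intro s
    have := ih t
    unfold pathLaw
    exact Kernel.IsMarkovKernel.map _ (measurable_update_prod t)

lemma lintegral_pathLaw_cons (t : T) (l : List T) (s : T) (x : ℝ) {F : (T → ℝ) → ENNReal}
    (hF : Measurable F) :
    ∫⁻ w, F w ∂(pathLaw K (t :: l) s x)
      = ∫⁻ y, ∫⁻ w, F (Function.update w t y) ∂(pathLaw K l t y) ∂(K s t x) := by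
  have hm : Measurable fun p : ℝ × (T → ℝ) => F (Function.update p.2 t p.1) :=
    hF.comp (measurable_update_prod t)
  rw [pathLaw, Kernel.lintegral_map _ (measurable_update_prod t) _ hF,
    Kernel.lintegral_compProd _ _ _ hm]
  simp

lemma measurable_lintegral_pathLaw_update (t : T) (l : List T) {F : (T → ℝ) → ENNReal}
    (hF : Measurable F) :
    Measurable fun y => ∫⁻ w, F (Function.update w t y) ∂(pathLaw K l t y) :=
  Measurable.lintegral_kernel_prod_right' (f := fun p : ℝ × (T → ℝ) => F (Function.update p.2 t p.1))
    (hF.comp (measurable_update_prod t))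

variable {K}

/-- Times at which a functional of the path does not look can be left out, by the
Chapman-Kolmogorov equation. -/
lemma lintegral_pathLaw_of_sublist
    (hCK : ∀ s t u, s ≤ t → t ≤ u → K t u ∘ₖ K s t = K s u) {l' l : List T} (h : l'.Sublist l) :
    ∀ (s : T) (x : ℝ) {F : (T → ℝ) → ENNReal}, Measurable F → l.Pairwise (· < ·) → (∀ t ∈ l, s ≤ t) →
      (∀ w w' : T → ℝ, (∀ t ∈ l', w t = w' t) → F w = F w') →
      ∫⁻ w, F w ∂(pathLaw K l s x) = ∫⁻ w, F w ∂(pathLaw K l' s x) := by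
  induction h with
  | slnil => intros; rfl
  | @cons l' l t hsub ih =>
    intro s x F hF hl hs hdep
    rw [List.pairwise_cons] at hl
    have htl' : t ∉ l' := fun ht => (hl.1 t (hsub.subset ht)).false
    have e : ∀ w y, F (Function.update w t y) = F w := fun w y =>
      hdep _ _ fun r hr => Function.update_of_ne (by rintro rfl; exact htl' hr) _ _
    rw [lintegral_pathLaw_cons K t l s x hF]
    simp only [e]
    have e2 : ∀ y, ∫⁻ w, F w ∂(pathLaw K l t y) = ∫⁻ w, F w ∂(pathLaw K l' t y) := fun y =>
      ih t y hF hl.2 (fun r hr => (hl.1 r hr).le) hdep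
    simp only [e2]
    rcases l' with _ | ⟨t', l'⟩
    · simp [pathLaw]
    · have htt' : t < t' := hl.1 t' (hsub.subset List.mem_cons_self)
      rw [lintegral_pathLaw_cons K t' l' s x hF, ← hCK s t t' (hs t List.mem_cons_self) htt'.le,
        Kernel.lintegral_comp _ _ _ (measurable_lintegral_pathLaw_update K t' l' hF)]
      simp only [lintegral_pathLaw_cons K t' l' t _ hF]
  | @cons_cons l' l t hsub ih =>
    intro s x F hF hl hs hdep
    rw [List.pairwise_cons] at hl
    rw [lintegral_pathLaw_cons K t l s x hF, lintegral_pathLaw_cons K t l' s x hF]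
    refine lintegral_congr fun y => ?_
    refine ih t y (hF.comp ((measurable_update_prod t).comp measurable_prodMk_left)) hl.2
      (fun r hr => (hl.1 r hr).le) fun w w' hw => hdep _ _ fun r hr => ?_
    by_cases hrt : r = t
    · subst hrt; simp
    · rw [Function.update_of_ne hrt, Function.update_of_ne hrt]
      exact hw r ((List.mem_cons.1 hr).resolve_left hrt)

/-- Disintegration of the path law at the last step. -/
lemma lintegral_pathLaw_append {s t : T} (hst : s < t) (l : List T) :
    ∀ (r : T) (x : ℝ) {F : (T → ℝ) → ENNReal}, Measurable F → (l ++ [s, t]).Pairwise (· < ·) →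
      ∫⁻ w, F w ∂(pathLaw K (l ++ [s, t]) r x)
        = ∫⁻ w, ∫⁻ y, F (Function.update w t y) ∂(K s t (w s)) ∂(pathLaw K (l ++ [s]) r x) := by
  induction l with
  | nil =>
    intro r x F hF hl
    have hm : Measurable fun w : T → ℝ => ∫⁻ y, F (Function.update w t y) ∂(K s t (w s)) := by
      have h1 : Measurable fun p : (T → ℝ) × ℝ => F (Function.update p.1 t p.2) :=
        hF.comp ((measurable_update_prod t).comp measurable_swap)
      exact h1.lintegral_kernel_prod_right' (κ := (K s t).comap (fun w : T → ℝ => w s) (by fun_prop))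
    rw [List.nil_append, List.nil_append, lintegral_pathLaw_cons K s _ r x hF,
      lintegral_pathLaw_cons K s _ r x hm]
    refine lintegral_congr fun y => ?_
    have h2 : Measurable fun w : T → ℝ => F (Function.update w s y) :=
      hF.comp ((measurable_update_prod s).comp measurable_prodMk_left)
    rw [lintegral_pathLaw_cons K t _ s y h2]
    simp only [pathLaw, Kernel.const_apply, Function.update_self]
    have h4 : Measurable fun w : T → ℝ =>
        ∫⁻ z, F (Function.update (Function.update w s y) t z) ∂(K s t y) := by
      have := hm.comp ((measurable_update_prod s).comp (measurable_prodMk_left (x := y)))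
      simpa [Function.comp_def] using this
    have h3 : ∀ z : ℝ, Measurable fun w : T → ℝ =>
        F (Function.update (Function.update w t z) s y) := fun z =>
      h2.comp ((measurable_update_prod t).comp measurable_prodMk_left)
    rw [lintegral_dirac' _ h4]
    refine lintegral_congr fun z => ?_
    rw [lintegral_dirac' _ (h3 z), Function.update_comm hst.ne]
  | cons a l ih =>
    intro r x F hF hl
    have hm : Measurable fun w : T → ℝ => ∫⁻ y, F (Function.update w t y) ∂(K s t (w s)) := by
      have h1 : Measurable fun p : (T → ℝ) × ℝ => F (Function.update p.1 t p.2) :=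
        hF.comp ((measurable_update_prod t).comp measurable_swap)
      exact h1.lintegral_kernel_prod_right' (κ := (K s t).comap (fun w : T → ℝ => w s) (by fun_prop))
    rw [List.cons_append, List.cons_append, lintegral_pathLaw_cons K a _ r x hF,
      lintegral_pathLaw_cons K a _ r x hm]
    rw [List.cons_append, List.pairwise_cons] at hl
    have has : s ≠ a := (hl.1 s (by simp)).ne'
    have hat : t ≠ a := (hl.1 t (by simp)).ne'
    refine lintegral_congr fun y => ?_
    have hFa : Measurable fun w : T → ℝ => F (Function.update w a y) :=
      hF.comp ((measurable_update_prod a).comp measurable_prodMk_left)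
    rw [ih a y hFa hl.2]
    simp only [Function.update_of_ne has, Function.update_comm hat]

variable (K)

/-- The law of the chain at the finitely many times of `I`, started from `x₀` at time `s₀`. -/
noncomputable def finiteDimLaw (s₀ : T) (x₀ : ℝ) (I : Finset T) : Measure (I → ℝ) :=
  (pathLaw K (I.sort (· ≤ ·)) s₀ x₀).map I.restrict

instance isProbabilityMeasure_finiteDimLaw (s₀ : T) (x₀ : ℝ) (I : Finset T) :
    IsProbabilityMeasure (finiteDimLaw K s₀ x₀ I) :=
  Measure.isProbabilityMeasure_map (Finset.measurable_restrict I).aemeasurable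

variable {K}

/-- Passing to fewer times means leaving out times that the functional does not look at. -/
lemma finiteDimLaw_isProjectiveMeasureFamily
    (hCK : ∀ s t u, s ≤ t → t ≤ u → K t u ∘ₖ K s t = K s u) {s₀ : T} (hs₀ : ∀ t, s₀ ≤ t) (x₀ : ℝ) :
    IsProjectiveMeasureFamily (α := fun _ : T => ℝ) (finiteDimLaw K s₀ x₀) := by
  intro I J hJI
  have hsub : (J.sort (· ≤ ·)).Sublist (I.sort (· ≤ ·)) := by
    refine List.sublist_of_subperm_of_pairwise ?_ (J.pairwise_sort _) (I.pairwise_sort _)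
    exact List.subperm_of_subset (J.sort_nodup _) fun t ht => by
      rw [Finset.mem_sort] at ht ⊢; exact hJI ht
  rw [finiteDimLaw, finiteDimLaw, Measure.map_map (Finset.measurable_restrict₂ hJI)
    (Finset.measurable_restrict I), Finset.restrict₂_comp_restrict]
  ext A hA
  have hm := Finset.measurable_restrict (X := fun _ : T => ℝ) J
  rw [Measure.map_apply hm hA, Measure.map_apply hm hA, ← lintegral_indicator_one (hm hA),
    ← lintegral_indicator_one (hm hA)]
  symm
  refine lintegral_pathLaw_of_sublist hCK hsub s₀ x₀ (measurable_one.indicator (hm hA))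
    (I.sortedLT_sort.pairwise) (fun t _ => hs₀ t) fun w w' hw => ?_
  have : J.restrict (π := fun _ => ℝ) w = J.restrict w' := by
    funext i
    exact hw i (by simp)
  by_cases h : J.restrict (π := fun _ => ℝ) w ∈ A
  · rw [Set.indicator_of_mem (by exact h),
      Set.indicator_of_mem (by rw [Set.mem_preimage, ← this]; exact h)]
    rfl
  · rw [Set.indicator_of_notMem (by exact h),
      Set.indicator_of_notMem (by rw [Set.mem_preimage, ← this]; exact h)]

omit [∀ s t, IsMarkovKernel (K s t)] in
/-- Integrals of functionals that depend on finitely many times, against a projective limit of the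
finite-dimensional laws. -/
lemma lintegral_projectiveLimit_finiteDimLaw {s₀ : T} {x₀ : ℝ} {P : Measure (T → ℝ)}
    (hP : IsProjectiveLimit (α := fun _ : T => ℝ) P (finiteDimLaw K s₀ x₀)) {l : List T}
    (hl : l.Pairwise (· < ·)) {F : (T → ℝ) → ENNReal} (hF : Measurable F)
    (hdep : ∀ w w' : T → ℝ, (∀ t ∈ l, w t = w' t) → F w = F w') :
    ∫⁻ w, F w ∂P = ∫⁻ w, F w ∂(pathLaw K l s₀ x₀) := by
  set I := l.toFinset with hI
  have hsort : I.sort (· ≤ ·) = l :=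
    (List.toFinset_sort (r := (· ≤ ·)) (hl.imp fun h => h.ne)).2 (hl.imp fun h => h.le)
  -- `F` factors through the restriction to `I`; `ext` is a measurable section of it
  set ext : (I → ℝ) → (T → ℝ) := fun v t => if h : t ∈ I then v ⟨t, h⟩ else 0 with hext
  have hextm : Measurable ext := by
    refine measurable_pi_lambda _ fun t => ?_
    by_cases h : t ∈ I
    · simp only [hext, h, dite_true]; fun_prop
    · simp only [hext, h, dite_false]; fun_prop
  have e : ∀ w, F w = F (ext (I.restrict w)) := fun w => hdep _ _ fun t ht => by
    have : t ∈ I := by simpa [hI] using ht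
    simp [hext, this]
  have hm := Finset.measurable_restrict (X := fun _ : T => ℝ) I
  have hFe : Measurable fun v => F (ext v) := hF.comp hextm
  calc ∫⁻ w, F w ∂P = ∫⁻ w, F (ext (I.restrict w)) ∂P := lintegral_congr e
    _ = ∫⁻ v, F (ext v) ∂(P.map I.restrict) := (lintegral_map hFe hm).symm
    _ = ∫⁻ v, F (ext v) ∂(finiteDimLaw K s₀ x₀ I) := by rw [hP I]
    _ = ∫⁻ w, F (ext (I.restrict w)) ∂(pathLaw K l s₀ x₀) := by
      rw [finiteDimLaw, hsort, lintegral_map hFe hm]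
    _ = ∫⁻ w, F w ∂(pathLaw K l s₀ x₀) := (lintegral_congr e).symm

end PathLaw

/-! ### The Markov property of the projective limit -/

section MarkovProperty

variable {T : Type*} [LinearOrder T] {K : T → T → Kernel ℝ ℝ} [∀ s t, IsMarkovKernel (K s t)]
  {s₀ : T} {x₀ : ℝ} {P : Measure (T → ℝ)}

/-- The Markov property tested on an event `B` that depends on finitely many times up to `s`. -/
lemma measure_inter_preimage_eq_setLIntegral
    (hP : IsProjectiveLimit (α := fun _ : T => ℝ) P (finiteDimLaw K s₀ x₀)) {s t : T} (hst : s < t)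
    {J : Finset T} (hJ : ∀ r ∈ J, r ≤ s) {B : Set (T → ℝ)} (hB : MeasurableSet B)
    (hdep : ∀ w w' : T → ℝ, (∀ r ∈ J, w r = w' r) → (w ∈ B ↔ w' ∈ B)) {A : Set ℝ}
    (hA : MeasurableSet A) :
    P (B ∩ (fun w => w t) ⁻¹' A) = ∫⁻ w in B, K s t (w s) A ∂P := by
  classical
  set l := (J.erase s).sort (· ≤ ·) with hl
  have hmem : ∀ r, r ∈ l ↔ r ≠ s ∧ r ∈ J := by simp [hl]
  have hls : ∀ r ∈ l, r < s := fun r hr =>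
    lt_of_le_of_ne (hJ r ((hmem r).1 hr).2) ((hmem r).1 hr).1
  have hJl : ∀ r ∈ J, r ∈ l ++ [s] := fun r hr => by
    by_cases h : r = s
    · simp [h]
    · simp [hmem, h, hr]
  have hpl : l.Pairwise (· < ·) := (J.erase s).sortedLT_sort.pairwise
  have hp1 : (l ++ [s]).Pairwise (· < ·) := by
    rw [List.pairwise_append]
    exact ⟨hpl, by simp, by simpa using hls⟩
  have hp2 : (l ++ [s, t]).Pairwise (· < ·) := by
    rw [List.pairwise_append]
    refine ⟨hpl, by simpa using hst, fun a ha b hb => ?_⟩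
    rcases List.mem_cons.1 hb with rfl | hb
    · exact hls a ha
    · rw [List.mem_singleton.1 hb]; exact (hls a ha).trans hst
  have hKm : Measurable fun w : T → ℝ => K s t (w s) A :=
    ((K s t).measurable_coe hA).comp (measurable_pi_apply s)
  have hAm : Measurable fun w : T → ℝ => A.indicator (1 : ℝ → ENNReal) (w t) :=
    (measurable_one.indicator hA).comp (measurable_pi_apply t)
  have hBm : Measurable (B.indicator (1 : (T → ℝ) → ENNReal)) := measurable_one.indicator hB
  have hBdep : ∀ w w' : T → ℝ, (∀ r ∈ J, w r = w' r) →
      B.indicator (1 : (T → ℝ) → ENNReal) w = B.indicator 1 w' := fun w w' h => by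
    simp only [Set.indicator_apply, hdep w w' h, Pi.one_apply]
  have e1 : P (B ∩ (fun w => w t) ⁻¹' A)
      = ∫⁻ w, B.indicator 1 w * A.indicator 1 (w t) ∂P := by
    rw [← lintegral_indicator_one (hB.inter (hA.preimage (measurable_pi_apply t))),
      Set.inter_indicator_one]
    rfl
  have e2 : ∫⁻ w in B, K s t (w s) A ∂P = ∫⁻ w, B.indicator 1 w * K s t (w s) A ∂P := by
    rw [← lintegral_indicator hB]
    refine lintegral_congr fun w => ?_
    by_cases h : w ∈ B <;> simp [h]
  have hBA : Measurable fun w : T → ℝ =>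
      B.indicator (1 : (T → ℝ) → ENNReal) w * A.indicator 1 (w t) := hBm.mul hAm
  have hBK : Measurable fun w : T → ℝ =>
      B.indicator (1 : (T → ℝ) → ENNReal) w * K s t (w s) A := hBm.mul hKm
  rw [e1, e2, lintegral_projectiveLimit_finiteDimLaw hP hp2 hBA fun w w' h => by
      rw [hBdep w w' fun r hr => h r (by have := hJl r hr; simp at this ⊢; tauto), h t (by simp)],
    lintegral_projectiveLimit_finiteDimLaw hP hp1 hBK fun w w' h => by
      rw [hBdep w w' fun r hr => h r (hJl r hr), h s (by simp)],
    lintegral_pathLaw_append hst l s₀ x₀ hBA hp2]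
  refine lintegral_congr fun w => ?_
  have hu : ∀ y, B.indicator (1 : (T → ℝ) → ENNReal) (Function.update w t y) = B.indicator 1 w :=
    fun y => hBdep _ _ fun r hr => Function.update_of_ne ((hJ r hr).trans_lt hst).ne _ _
  simp only [hu, Function.update_self]
  rw [lintegral_const_mul _ (measurable_one.indicator hA), lintegral_indicator_one hA]

/-- A conditional probability given a `σ`-algebra is identified by its integrals over a generating
`π`-system. -/
lemma condProb_ae_eq_of_isPiSystem {Ω : Type*} {m m₀ : MeasurableSpace Ω} {P : Measure Ω}
    [IsProbabilityMeasure P] (hm : m ≤ m₀) {C : Set (Set Ω)}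
    (hgen : m = MeasurableSpace.generateFrom C) (hC : IsPiSystem C) (huniv : Set.univ ∈ C)
    {E : Set Ω} (hE : MeasurableSet E) {g : Ω → ENNReal} (hg : Measurable[m] g)
    (hg1 : ∀ ω, g ω ≤ 1) (h : ∀ B ∈ C, P (B ∩ E) = ∫⁻ ω in B, g ω ∂P) :
    P⟦E | m⟧ =ᵐ[P] fun ω => (g ω).toReal := by
  have hg0 : Measurable g := hg.mono hm le_rfl
  have hfin : ∀ B : Set Ω, ∫⁻ ω in B, g ω ∂P ≠ ⊤ := fun B =>
    ((lintegral_mono hg1).trans_lt (by simp : ∫⁻ _ in B, 1 ∂P < ⊤)).ne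
  have hfin1 : IsFiniteMeasure (P.withDensity g) :=
    isFiniteMeasure_withDensity (by simpa using hfin Set.univ)
  have key : ∀ B : Set Ω, MeasurableSet[m] B → P (B ∩ E) = ∫⁻ ω in B, g ω ∂P := by
    have hmeas : ∀ B ∈ C, MeasurableSet[m] B := fun B hB => by
      rw [hgen]; exact MeasurableSpace.measurableSet_generateFrom hB
    have heq : (P.restrict E).trim hm = (P.withDensity g).trim hm := by
      refine @ext_of_generate_finite _ m _ _ C hgen hC _ (fun B hB => ?_) ?_
      · have hB' := hmeas B hB
        rw [trim_measurableSet_eq hm hB', trim_measurableSet_eq hm hB',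
          Measure.restrict_apply (hm _ hB'), withDensity_apply _ (hm _ hB'), h B hB]
      · rw [trim_measurableSet_eq hm .univ, trim_measurableSet_eq hm .univ,
          Measure.restrict_apply .univ, withDensity_apply _ .univ]
        exact h _ huniv
    intro B hB
    have := congrArg (fun μ => μ B) heq
    simp only [trim_measurableSet_eq hm hB] at this
    rwa [Measure.restrict_apply (hm _ hB), withDensity_apply _ (hm _ hB)] at this
  refine (ae_eq_condExp_of_forall_setIntegral_eq hm ((integrable_const _).indicator hE)
    (fun B _ _ => integrable_toReal_of_lintegral_ne_top hg0.aemeasurable (hfin B)) (fun B hB _ => ?_)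
    hg.ennreal_toReal.stronglyMeasurable.aestronglyMeasurable).symm
  rw [setIntegral_indicator hE, setIntegral_const, smul_eq_mul, mul_one, measureReal_def, key B hB]
  exact integral_toReal hg0.aemeasurable
    (ae_of_all _ fun ω => (hg1 ω).trans_lt ENNReal.one_lt_top)

/-- Under a projective limit of the finite-dimensional laws, the conditional law of the coordinate
at time `t` given the coordinates up to time `s < t` is `K s t`. The cylinders over times up to `s`
are a `π`-system that generates the past of `s`, so it is enough to integrate over them. -/
theorem condProb_projectiveLimit_finiteDimLaw [IsProbabilityMeasure P]
    (hP : IsProjectiveLimit (α := fun _ : T => ℝ) P (finiteDimLaw K s₀ x₀)) {s t : T} (hst : s < t)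
    {A : Set ℝ} (hA : MeasurableSet A) :
    P⟦(fun w : T → ℝ => w t) ⁻¹' A |
        ⨆ r ≤ s, MeasurableSpace.comap (fun w : T → ℝ => w r) inferInstance⟧
      =ᵐ[P] fun w => (K s t (w s)).real A := by
  have hm : ⨆ r ≤ s, MeasurableSpace.comap (fun w : T → ℝ => w r) inferInstance
      ≤ MeasurableSpace.pi := iSup₂_le fun r _ => (measurable_pi_apply r).comap_le
  refine condProb_ae_eq_of_isPiSystem (g := fun w => K s t (w s) A) hm
    (generateFrom_piiUnionInter_measurableSet
      (fun r : T => MeasurableSpace.comap (fun w : T → ℝ => w r) inferInstance) (Set.Iic s)).symm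
    (isPiSystem_piiUnionInter _ (fun r => @MeasurableSpace.isPiSystem_measurableSet _ (_)) _)
    ⟨∅, by simp, fun _ => Set.univ, by simp, by simp⟩ (hA.preimage (measurable_pi_apply t))
    (((K s t).measurable_coe hA).comp ?_) (fun w => prob_le_one) fun B hBmem => ?_
  · exact Measurable.mono (comap_measurable _) (le_iSup₂ (f := fun r (_ : r ≤ s) =>
      MeasurableSpace.comap (fun w : T → ℝ => w r) inferInstance) s le_rfl) le_rfl
  · have hB : MeasurableSet B := hm _ (measurableSet_iSup_of_mem_piiUnionInter _ _ B hBmem)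
    obtain ⟨J, hJ, f, hf, rfl⟩ := hBmem
    refine measure_inter_preimage_eq_setLIntegral hP hst (fun r hr => hJ hr) hB
      (fun w w' h => ?_) hA
    simp only [Set.mem_iInter]
    refine forall₂_congr fun r hr => ?_
    obtain ⟨S, -, hS⟩ := hf r hr
    rw [← hS, Set.mem_preimage, Set.mem_preimage, h r hr]

lemma ae_projectiveLimit_finiteDimLaw_eq (hid : K s₀ s₀ = Kernel.id)
    (hP : IsProjectiveLimit (α := fun _ : T => ℝ) P (finiteDimLaw K s₀ x₀)) :
    ∀ᵐ w ∂P, w s₀ = x₀ := by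
  have hS : MeasurableSet {w : T → ℝ | ¬ w s₀ = x₀} :=
    (measurableSet_eq_fun (measurable_pi_apply s₀) measurable_const).compl
  rw [ae_iff, ← lintegral_indicator_one hS,
    lintegral_projectiveLimit_finiteDimLaw hP (l := [s₀]) (by simp) (measurable_one.indicator hS)
      fun w w' h => by simp [Set.indicator_apply, h s₀ (by simp)],
    lintegral_pathLaw_cons _ _ _ _ _ (measurable_one.indicator hS), hid, Kernel.id_apply,
    lintegral_dirac' _ (measurable_lintegral_pathLaw_update K s₀ [] (measurable_one.indicator hS))]
  simp

end MarkovProperty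

/-! ### The Markov process -/

/-- The transition kernel of the process between two times; the identity unless `s < t`, which keeps
the Chapman-Kolmogorov equation true for `s ≤ t`. -/
noncomputable def qMeixnerTransition {q τ : ℝ} (hq : |q| ≤ 1) (hτ : 0 ≤ τ) (θ : ℝ) (s t : ℝ≥0) :
    Kernel ℝ ℝ :=
  if h : s < t then
    qMeixnerKernel q θ τ s t (measurable_qMeixnerMeasure hq hτ s.coe_nonneg (by exact_mod_cast h) θ)
  else Kernel.id

section Transition

variable {q τ : ℝ} (hq : |q| ≤ 1) (hτ : 0 ≤ τ) (θ : ℝ)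

lemma qMeixnerTransition_apply {s t : ℝ≥0} (hst : s < t) (x : ℝ) :
    qMeixnerTransition hq hτ θ s t x = qMeixnerMeasure q θ τ x s t := by
  rw [qMeixnerTransition, dif_pos hst]; rfl

lemma qMeixnerTransition_self (s : ℝ≥0) : qMeixnerTransition hq hτ θ s s = Kernel.id := by
  rw [qMeixnerTransition, dif_neg (lt_irrefl s)]

instance isMarkovKernel_qMeixnerTransition (s t : ℝ≥0) :
    IsMarkovKernel (qMeixnerTransition hq hτ θ s t) := by
  by_cases h : s < t
  · refine ⟨fun x => ?_⟩
    rw [qMeixnerTransition_apply hq hτ θ h]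
    exact (qMeixnerMeasure_isOrthogonalityMeasure hq hτ s.coe_nonneg
      (by exact_mod_cast h) θ x).isProbabilityMeasure
  · rw [qMeixnerTransition, dif_neg h]; infer_instance

lemma qMeixnerTransition_comp {s t u : ℝ≥0} (hst : s ≤ t) (htu : t ≤ u) :
    qMeixnerTransition hq hτ θ t u ∘ₖ qMeixnerTransition hq hτ θ s t
      = qMeixnerTransition hq hτ θ s u := by
  rcases hst.eq_or_lt with rfl | hst
  · rw [qMeixnerTransition_self, Kernel.comp_id]
  rcases htu.eq_or_lt with rfl | htu
  · rw [qMeixnerTransition_self, Kernel.id_comp]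
  ext1 x
  rw [Kernel.comp_apply, qMeixnerTransition_apply hq hτ θ hst,
    qMeixnerTransition_apply hq hτ θ (hst.trans htu),
    ← bind_qMeixnerMeasure hq hτ s.coe_nonneg (NNReal.coe_lt_coe.2 hst) (NNReal.coe_lt_coe.2 htu)]
  congr 1
  funext y
  exact qMeixnerTransition_apply hq hτ θ htu y

end Transition


theorem mainTheorem5 (q θ τ : ℝ) (hq : -1 ≤ q) (hq' : q ≤ 1) (hτ : 0 ≤ τ) :
    -- `μ_{x,s,t}` is well defined: it is the unique orthogonality measure of `Q_n(· | x, s, t)`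
    (∀ x s t : ℝ, 0 ≤ s → s < t →
      IsOrthogonalityMeasure (qMeixnerPoly q θ τ x s t) (qMeixnerMeasure q θ τ x s t) ∧
      ∀ ν : Measure ℝ, IsOrthogonalityMeasure (qMeixnerPoly q θ τ x s t) ν →
        ν = qMeixnerMeasure q θ τ x s t) ∧
    -- `μ_{x,s,t}` depends measurably on `x`
    (∀ s t : ℝ, 0 ≤ s → s < t → Measurable fun x : ℝ => qMeixnerMeasure q θ τ x s t) ∧
    -- the Chapman-Kolmogorov equation
    (∀ x s t u : ℝ, 0 ≤ s → s < t → t < u → ∀ A : Set ℝ, MeasurableSet A →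
      qMeixnerMeasure q θ τ x s u A
        = ∫⁻ y, qMeixnerMeasure q θ τ y t u A ∂(qMeixnerMeasure q θ τ x s t)) ∧
    -- they are the transition probabilities of a Markov process, from every starting point
    (∀ x₀ : ℝ, ∃ (Ω : Type) (_ : MeasurableSpace Ω) (P : Measure Ω) (X : ℝ≥0 → Ω → ℝ),
      IsMarkovProcessWithTransitions P X
        (fun s t x => qMeixnerMeasure q θ τ x (s : ℝ) (t : ℝ)) x₀) := by
  have hq1 : |q| ≤ 1 := abs_le.2 ⟨hq, hq'⟩
  refine ⟨fun x s t hs hst => ⟨qMeixnerMeasure_isOrthogonalityMeasure hq1 hτ hs hst θ x,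
      fun ν hν => ?_⟩,
    fun s t hs hst => measurable_qMeixnerMeasure hq1 hτ hs hst θ,
    fun x s t u hs hst htu A hA => ?_, fun x₀ => ?_⟩
  · have := hν.isProbabilityMeasure
    refine eq_qMeixnerMeasure hq1 hτ hs hst θ x hν.integrable_pow fun n hn => ?_
    simpa [qMeixnerPoly] using hν.orthogonal n 0 (by omega)
  · rw [← bind_qMeixnerMeasure hq1 hτ hs hst htu θ x, Measure.bind_apply hA
      (measurable_qMeixnerMeasure hq1 hτ (hs.trans hst.le) htu θ).aemeasurable]
  · set K := qMeixnerTransition hq1 hτ θ with hK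
    -- Kolmogorov's extension theorem gives the law of the process on the space of all paths.
    obtain ⟨P, hP⟩ := exists_isProjectiveLimit (finiteDimLaw_isProjectiveMeasureFamily
      (K := K) (fun s t u => qMeixnerTransition_comp hq1 hτ θ) (s₀ := 0) (fun _ => zero_le) x₀)
    have hPp : IsProbabilityMeasure P := hP.isProbabilityMeasure
    refine ⟨ℝ≥0 → ℝ, inferInstance, P, fun t w => w t, hPp, fun t => measurable_pi_apply t,
      ae_projectiveLimit_finiteDimLaw_eq (qMeixnerTransition_self hq1 hτ θ 0) hP,
      fun s t hst A hA => ?_⟩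
    refine (condProb_projectiveLimit_finiteDimLaw hP hst hA).trans (ae_of_all _ fun w => ?_)
    simp only [hK, qMeixnerTransition_apply hq1 hτ θ hst]
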